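/- Let $S_1$ be the unit circle, $\theta_0\in(0,\pi)$, $\gamma=\{e^{i\theta}:-\theta_0\le\theta\le\theta_0\}$ and $x_c=-2\ln\tan\frac{\theta_0}{4}$. For $x\in(0,+\infty]$ let $V=0$ on $\gamma$ and $V=x$ on $S_1\setminus\gamma$. The equilibrium measure $\mu=\mu^{(x)}$ is the unique minimizer of $$\iint \log|z-s|^{-1}\,d\mu(z)\,d\mu(s)+\int V(z)\,d\mu(z)$$ among all Borel probability measures on $S_1$; $J$ denotes its support, and we write $d\mu=u(e^{i\theta})\,d\theta$. The variational conditions with constant $\ell\in\mathbb R$ are $$\text{(EL1)}\quad 2\int\log|z-s|\,d\mu(s)-V(z)+\ell=0\ \ (z\in J),\qquad \text{(EL2)}\quad 2\int\log|z-s|\,d\mu(s)-V(z)+\ell\le 0\ \ (z\in S_1\setminus J).$$ (a), (b) Let $x_c\le x\le+\infty$. The equilibrium measure exists and is unique, its support is $J=\gamma$, and its density on $\gamma$ is $$u(e^{i\theta})=\frac1{2\pi}\sqrt{\frac{\cos\theta+1}{\cos\theta-\cos\theta_0}}.$$ The variational conditions hold for exactly one constant, namely $\ell=-2\ln\sin\frac{\theta_0}{2}$.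 If $x\ne x_c$ (in particular if $x=+\infty$), the inequality (EL2) is strict for all $z\in S_1\setminus\gamma$; if $x=x_c$, it is strict for all $z\in S_1\setminus(\gamma\cup\{-1\})$, and there is equality at $z=-1$. (c) Let $0<x<x_c$. There is exactly one $\theta_1\in(0,\pi-\theta_0)$ such that, with $$u(e^{i\theta})=\frac1{2\pi}\sqrt{\frac{\cos\theta+\cos\theta_1}{\cos\theta-\cos\theta_0}},$$ one has $$2\int_{[-\theta_0,\theta_0]\cup[\pi-\theta_1,\pi+\theta_1]}\log\left|\frac{1+e^{i\theta}}{1-e^{i\theta}}\right|u(e^{i\theta})\,d\theta=x.$$ For this $\theta_1$, the equilibrium measure exists and is unique, its support is the union of two disjoint arcs $$J=\{e^{i\theta}:\theta\in[-\theta_0,\theta_0]\cup[\pi-\theta_1,\pi+\theta_1]\},$$ and its density on $J$ is the function $u$ above. The variational conditions hold for exactly one constant, namely $$\ell=-\int_0^1\frac1s\left(1-\sqrt{\frac{s^2+2\cos(\theta_1)s+1}{s^2-2\cos(\theta_0)s+1}}\right)ds,$$ and (EL2) is strict for all $z\in S_1\setminus J$. -/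

import Mathlib

open Real Set MeasureTheory

namespace CircleEquilibrium

/-- The unit circle carries its Borel σ-algebra. -/
noncomputable instance instMeasurableSpaceCircle : MeasurableSpace Circle := borel Circle

instance instBorelSpaceCircle : BorelSpace Circle := ⟨rfl⟩

/-- The integral of an extended-real function, as the difference of the integrals of its positive
and negative parts. It is only used below for integrands for which at least one of the two
parts has a finite integral. -/
noncomputable def extIntegral {α : Type*} [MeasurableSpace α] (μ : Measure α) (f : α → EReal) :
    EReal :=
  ((∫⁻ a, (f a).toENNReal ∂μ : ENNReal) : EReal) - ((∫⁻ a, (-f a).toENNReal ∂μ : ENNReal) : EReal)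

/-- `log |z - w|`, with value `-∞` for `z = w`. -/
noncomputable def logDist (z w : Circle) : EReal :=
  ENNReal.log ‖(z : ℂ) - (w : ℂ)‖ₑ

/-- The weighted logarithmic energy `∬ log |z - s|⁻¹ dμ(z) dμ(s) + ∫ V dμ`. -/
noncomputable def energy (V : Circle → EReal) (μ : Measure Circle) : EReal :=
  extIntegral (μ.prod μ) (fun p => -logDist p.1 p.2) + extIntegral μ V

/-- `μ` minimizes the energy among all Borel probability measures on the unit circle. -/
def IsEquilibriumMeasure (V : Circle → EReal) (μ : Measure Circle) : Prop :=
  IsProbabilityMeasure μ ∧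
    ∀ ν : Measure Circle, IsProbabilityMeasure ν → energy V μ ≤ energy V ν

/-- The left-hand side `2 ∫ log |z - s| dμ(s) - V(z) + ℓ` of the Euler–Lagrange conditions. -/
noncomputable def eulerLagrange (V : Circle → EReal) (μ : Measure Circle) (ℓ : ℝ) (z : Circle) :
    EReal :=
  2 * extIntegral μ (logDist z) - V z + (ℓ : EReal)

/-- The Euler–Lagrange variational conditions, with constant `ℓ`. -/
def SatisfiesEulerLagrange (V : Circle → EReal) (μ : Measure Circle) (ℓ : ℝ) : Prop :=
  (∀ z ∈ μ.support, eulerLagrange V μ ℓ z = 0) ∧ (∀ z ∉ μ.support, eulerLagrange V μ ℓ z ≤ 0)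

/-- The subset `{e^{iθ} : θ ∈ A}` of the unit circle. -/
noncomputable def arcSet (A : Set ℝ) : Set Circle := Circle.exp '' A

/-- The measure `u(e^{iθ}) dθ`, `θ ∈ A`, on the unit circle, where `v θ = u(e^{iθ})`; here `A` is a
set of angles on which `θ ↦ e^{iθ}` is injective. -/
noncomputable def angularMeasure (A : Set ℝ) (v : ℝ → ℝ) : Measure Circle :=
  ((volume.restrict A).withDensity (fun θ => ENNReal.ofReal (v θ))).map Circle.exp

/-- The arc `γ = {e^{iθ} : -θ₀ ≤ θ ≤ θ₀}`. -/
noncomputable def gammaArc (θ₀ : ℝ) : Set Circle := arcSet (Icc (-θ₀) θ₀)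

open Classical in
/-- The potential `V`: zero on `γ` and `x ∈ (0, +∞]` off `γ`. -/
noncomputable def potential (θ₀ : ℝ) (x : EReal) (z : Circle) : EReal :=
  if z ∈ gammaArc θ₀ then 0 else x

/-- `x_c = -2 ln tan (θ₀ / 4)`. -/
noncomputable def xCrit (θ₀ : ℝ) : ℝ := -2 * Real.log (Real.tan (θ₀ / 4))

/-- `(1 / 2π) √((cos θ + 1) / (cos θ - cos θ₀))`. -/
noncomputable def oneArcDensity (θ₀ θ : ℝ) : ℝ :=
  1 / (2 * π) * √((Real.cos θ + 1) / (Real.cos θ - Real.cos θ₀))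

/-- `(1 / 2π) √((cos θ + cos θ₁) / (cos θ - cos θ₀))`. -/
noncomputable def twoArcDensity (θ₀ θ₁ θ : ℝ) : ℝ :=
  1 / (2 * π) * √((Real.cos θ + Real.cos θ₁) / (Real.cos θ - Real.cos θ₀))

/-- The angles `[-θ₀, θ₀] ∪ [π - θ₁, π + θ₁]`. -/
noncomputable def twoArcAngles (θ₀ θ₁ : ℝ) : Set ℝ :=
  Icc (-θ₀) θ₀ ∪ Icc (π - θ₁) (π + θ₁)

/-- The equation `2 ∫ log |(1 + e^{iθ}) / (1 - e^{iθ})| u(e^{iθ}) dθ = x` for `θ₁`, the integral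
being over `[-θ₀, θ₀] ∪ [π - θ₁, π + θ₁]`. -/
def EndpointEquation (θ₀ x θ₁ : ℝ) : Prop :=
  2 * ∫ θ in twoArcAngles θ₀ θ₁,
    Real.log ‖(1 + (Circle.exp θ : ℂ)) / (1 - (Circle.exp θ : ℂ))‖ *
      twoArcDensity θ₀ θ₁ θ = x

/-- The integrand `(1 / s) (1 - √((s² + 2 s cos θ₁ + 1) / (s² - 2 s cos θ₀ + 1)))`. -/
noncomputable def ellIntegrand (θ₀ θ₁ s : ℝ) : ℝ :=
  1 / s * (1 - √((s ^ 2 + 2 * Real.cos θ₁ * s + 1) / (s ^ 2 - 2 * Real.cos θ₀ * s + 1)))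

end CircleEquilibrium

/-!
# Equilibrium measures on the circle with a step field

The one-arc density is the two-arc density with `θ₁ = 0`, so both regimes are treated together, for
`0 ≤ θ₁ < π - θ₀`. Write `a = cos θ₁`, `c = cos θ₀`, and let `F` be the principal square root of
`(z² + 2az + 1) / (z² - 2cz + 1)` in the unit disc (`discRoot`). The quotient avoids the half-line
`(-∞, 0]` there, because its imaginary part has the sign of `Im z` (`im_discRatio`) and it is
positive for real `z`; so `F` is holomorphic with `F 0 = 1`. At `e^{iθ}` the quotient takes the real
value `(cos θ + a) / (cos θ - c)` (`circleRatio`): on the arcs it is nonnegative and `F` tends to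
`2π u`, while on the gaps it is nonpositive and `F` becomes purely imaginary. Hence `Re F` has
boundary values `2π u`, extended by zero, and the Herglotz formula (`Admissible.herglotz`) says that
`F` is the Herglotz transform `∫ (s + z) / (s - z) dμ(s)` of `dμ = u dθ`. At `z = 0` this shows
that `μ` has mass `1`.

The function `G z = ∫ log (1 - z / s) dμ(s)` satisfies `2 z G' = 1 - F`. Integrating this along the
radius to `1` and then along the circle gives the logarithmic potential
(`Admissible.integral_log_twoArcMeasure`)
`2 ∫ log |e^{iφ} - s| dμ(s) = ∫₀¹ (1 - F s) / s ds + ∫₀^|φ| Im F (e^{it}) dt`.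
The first term is `-ℓ`. The second one, the integral of `gapDensity`, vanishes on `γ`, increases
strictly across the gap and is constant on the second arc, where its value is `gapIntegral θ₀ θ₁`.
The endpoint equation says that this value is `x` (`Admissible.endpointEquation_iff`). It decreases
strictly and continuously in `θ₁`, from `x_c` at `θ₁ = 0` (`gapIntegral_zero`) to `0` at
`θ₁ = π - θ₀`, which gives existence and uniqueness of `θ₁`; comparing the increment with the field
gives the variational conditions and their strictness (`Admissible.eulerLagrange_eq`).

Conversely these conditions characterize the minimizer (`isEquilibriumMeasure_iff_eq`): for a
probability measure `ν` of finite energy, `energy ν - energy μ` is at least the logarithmic energy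
of `ν - μ`. Replacing the kernel `-log |1 - w|` by `-log |1 - r w| = ∑ rⁿ Re (wⁿ) / n` and letting
`r → 1` bounds that energy below by `|ν̂(n) - μ̂(n)|² / n` for every `n ≥ 1`
(`norm_sq_integral_pow_sub_le`), and a measure on the circle is determined by its Fourier
coefficients.
-/

open Filter Topology ComplexConjugate Interval

namespace CircleEquilibrium

/-! ### The logarithmic kernel -/

/-- For an integrand that agrees almost everywhere with a real integrable function, the
extended-real integral is the Bochner integral. -/
lemma coe_extIntegral {α : Type*} [MeasurableSpace α] {μ : Measure α} {f : α → EReal} {g : α → ℝ}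
    (hg : Integrable g μ) (hfg : ∀ᵐ a ∂μ, f a = (g a : EReal)) :
    extIntegral μ f = ((∫ a, g a ∂μ : ℝ) : EReal) := by
  have h1 : ∫⁻ a, (f a).toENNReal ∂μ = ∫⁻ a, ENNReal.ofReal (g a) ∂μ :=
    lintegral_congr_ae (hfg.mono fun a ha => by simp [ha])
  have h2 : ∫⁻ a, (-f a).toENNReal ∂μ = ∫⁻ a, ENNReal.ofReal (-g a) ∂μ :=
    lintegral_congr_ae (hfg.mono fun a ha => by simp [ha, ← EReal.coe_neg])
  have e1 : ∫⁻ a, ENNReal.ofReal (g a) ∂μ ≠ ⊤ := hg.lintegral_lt_top.ne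
  have e2 : ∫⁻ a, ENNReal.ofReal (-g a) ∂μ ≠ ⊤ := hg.neg.lintegral_lt_top.ne
  rw [extIntegral, h1, h2, integral_eq_lintegral_pos_part_sub_lintegral_neg_part hg,
    EReal.coe_sub, EReal.coe_ennreal_toReal e1, EReal.coe_ennreal_toReal e2]

lemma logDist_of_ne {z w : Circle} (h : z ≠ w) :
    logDist z w = ((Real.log ‖(z : ℂ) - w‖ : ℝ) : EReal) := by
  have : 0 < ‖(z : ℂ) - w‖ := by
    rw [norm_pos_iff, sub_ne_zero]
    exact fun h' => h (Circle.ext h')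
  rw [logDist, ← ofReal_norm, ENNReal.log_ofReal_of_pos this]

lemma logDist_self (z : Circle) : logDist z z = ⊥ := by
  simp [logDist]

lemma norm_coe_sub_le (z w : Circle) : ‖(z : ℂ) - w‖ ≤ 2 := by
  calc ‖(z : ℂ) - w‖ ≤ ‖(z : ℂ)‖ + ‖(w : ℂ)‖ := norm_sub_le _ _
    _ = 2 := by rw [Circle.norm_coe, Circle.norm_coe]; norm_num

lemma norm_one_sub_inv_mul (z w : Circle) :
    ‖1 - ((z⁻¹ * w : Circle) : ℂ)‖ = ‖(z : ℂ) - w‖ := by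
  have : (1 : ℂ) - ((z⁻¹ * w : Circle) : ℂ) = (z : ℂ)⁻¹ * (z - w) := by
    push_cast
    field_simp [z.coe_ne_zero]
  rw [this, norm_mul, norm_inv, Circle.norm_coe, inv_one, one_mul]

lemma log_norm_coe_sub_le (z w : Circle) : Real.log ‖(z : ℂ) - w‖ ≤ Real.log 2 := by
  rcases (norm_nonneg ((z : ℂ) - w)).eq_or_lt with h | h
  · rw [← h, Real.log_zero]
    positivity
  · exact Real.log_le_log h (norm_coe_sub_le z w)

lemma abs_log_norm_coe_sub_le (z w : Circle) :
    |Real.log ‖(z : ℂ) - w‖| ≤ 2 * Real.log 2 - Real.log ‖(z : ℂ) - w‖ := by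
  have h := log_norm_coe_sub_le z w
  have h2 : 0 ≤ Real.log 2 := by positivity
  rw [abs_le]
  constructor <;> linarith

lemma measurable_log_norm_coe_sub :
    Measurable fun p : Circle × Circle => Real.log ‖(p.1 : ℂ) - p.2‖ := by
  have : Continuous fun p : Circle × Circle => ‖(p.1 : ℂ) - p.2‖ := by fun_prop
  exact Real.measurable_log.comp this.measurable

lemma measurable_logDist : Measurable fun p : Circle × Circle => logDist p.1 p.2 := by
  have : Continuous fun p : Circle × Circle => ‖(p.1 : ℂ) - p.2‖ₑ := by fun_prop
  exact ENNReal.measurable_log.comp this.measurable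

/-! ### Radial regularization of the logarithmic kernel -/

/-- A radial contraction brings a point of the circle closer to `1` by a factor `2` at most; this
makes the regularized kernels uniformly dominated. -/
lemma norm_one_sub_le_two_mul {r : ℝ} (hr0 : 0 ≤ r) (hr : r ≤ 1) (w : Circle) :
    ‖1 - (w : ℂ)‖ ≤ 2 * ‖1 - r * (w : ℂ)‖ := by
  have h1 : 1 - r ≤ ‖1 - r * (w : ℂ)‖ := by
    have := norm_sub_norm_le (1 : ℂ) (r * (w : ℂ))
    rwa [norm_mul, Circle.norm_coe, norm_one, Complex.norm_real, Real.norm_of_nonneg hr0,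
      mul_one] at this
  have h2 : ‖1 - (w : ℂ)‖ ≤ ‖1 - r * (w : ℂ)‖ + ‖((r - 1 : ℝ) : ℂ) * w‖ := by
    refine le_trans (le_of_eq ?_) (norm_add_le _ _)
    push_cast
    ring_nf
  rw [norm_mul, Circle.norm_coe, Complex.norm_real, Real.norm_eq_abs, abs_of_nonpos (by linarith),
    mul_one] at h2
  linarith

lemma abs_log_norm_one_sub_mul_le {r : ℝ} (hr0 : 0 ≤ r) (hr : r ≤ 1) {w : Circle} (hw : w ≠ 1) :
    |Real.log ‖1 - r * (w : ℂ)‖| ≤ |Real.log ‖1 - (w : ℂ)‖| + Real.log 2 := by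
  have h0 : 0 < ‖1 - (w : ℂ)‖ := by
    rw [norm_pos_iff, sub_ne_zero]
    exact fun h' => hw (Circle.ext (by simpa using h'.symm))
  have h1 := norm_one_sub_le_two_mul hr0 hr w
  have h2 : 0 < ‖1 - r * (w : ℂ)‖ := by linarith
  have h3 : ‖1 - r * (w : ℂ)‖ ≤ 2 := by
    calc ‖1 - r * (w : ℂ)‖ ≤ ‖(1 : ℂ)‖ + ‖r * (w : ℂ)‖ := norm_sub_le _ _
      _ ≤ 2 := by
        rw [norm_mul, Circle.norm_coe, norm_one, Complex.norm_real, Real.norm_of_nonneg hr0]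
        linarith
  have h4 := Real.log_le_log h0 h1
  rw [Real.log_mul (by norm_num) h2.ne'] at h4
  have h5 := Real.log_le_log h2 h3
  rw [abs_le]
  constructor
  · linarith [neg_abs_le (Real.log ‖1 - (w : ℂ)‖)]
  · linarith [abs_nonneg (Real.log ‖1 - (w : ℂ)‖)]

/-- Removal of the regularization, for a kernel that is already known to be integrable. -/
lemma tendsto_integral_log_norm_one_sub {α : Type*} [MeasurableSpace α] {ρ : Measure α}
    [IsFiniteMeasure ρ] {w : α → Circle} (hw : Measurable w) (h1 : ∀ᵐ a ∂ρ, w a ≠ 1)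
    (hint : Integrable (fun a => Real.log ‖1 - (w a : ℂ)‖) ρ) :
    Tendsto (fun r : ℝ => ∫ a, Real.log ‖1 - r * (w a : ℂ)‖ ∂ρ) (𝓝[<] 1)
      (𝓝 (∫ a, Real.log ‖1 - (w a : ℂ)‖ ∂ρ)) := by
  have hwc : Measurable fun a => (w a : ℂ) :=
    (by fun_prop : Continuous fun z : Circle => (z : ℂ)).measurable.comp hw
  have hev : ∀ᶠ r : ℝ in 𝓝[<] 1, 0 ≤ r ∧ r ≤ 1 := by
    filter_upwards [Ioo_mem_nhdsLT (zero_lt_one' ℝ)] with r hr using ⟨hr.1.le, hr.2.le⟩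
  refine tendsto_integral_filter_of_dominated_convergence
    (fun a => |Real.log ‖1 - (w a : ℂ)‖| + Real.log 2) ?_ ?_ (hint.abs.add (integrable_const _)) ?_
  · exact Eventually.of_forall fun r =>
      (Real.measurable_log.comp (by fun_prop)).aestronglyMeasurable
  · filter_upwards [hev] with r hr
    filter_upwards [h1] with a ha using abs_log_norm_one_sub_mul_le hr.1 hr.2 ha
  · filter_upwards [h1] with a ha
    have h0 : ‖1 - ((1 : ℝ) : ℂ) * (w a : ℂ)‖ ≠ 0 := by
      rw [Complex.ofReal_one, one_mul, norm_ne_zero_iff, sub_ne_zero]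
      exact fun h' => ha (Circle.ext (by simpa using h'.symm))
    have hc : ContinuousAt (fun r : ℝ => Real.log ‖1 - (r : ℂ) * (w a : ℂ)‖) 1 :=
      ContinuousAt.log (by fun_prop) h0
    have := hc.tendsto.mono_left (nhdsWithin_le_nhds (s := Iio 1))
    simpa using this

/-! ### Positivity of the logarithmic energy -/

/-- The regularized mutual energy of two measures on the circle, in terms of their Fourier
coefficients. The term `n = 0` of the series is `0`, by the convention `1 / 0 = 0`. -/
lemma hasSum_neg_integral_log_norm_one_sub (α β : Measure Circle) [IsProbabilityMeasure α]
    [IsProbabilityMeasure β] {r : ℝ} (hr0 : 0 ≤ r) (hr : r < 1) :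
    HasSum (fun n : ℕ => r ^ n / n * (conj (∫ z, (z : ℂ) ^ n ∂α) * ∫ z, (z : ℂ) ^ n ∂β).re)
      (-∫ p, Real.log ‖1 - r * ((p.1⁻¹ * p.2 : Circle) : ℂ)‖ ∂α.prod β) := by
  set F : ℕ → Circle × Circle → ℝ := fun n p =>
    ((r * ((p.1⁻¹ * p.2 : Circle) : ℂ)) ^ n / n).re with hF
  have hnorm : ∀ p : Circle × Circle, ‖r * ((p.1⁻¹ * p.2 : Circle) : ℂ)‖ = r := fun p => by
    rw [norm_mul, Circle.norm_coe, Complex.norm_real, Real.norm_of_nonneg hr0, mul_one]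
  have hbound : ∀ n p, ‖F n p‖ ≤ r ^ n := fun n p => by
    refine (Complex.abs_re_le_norm _).trans ?_
    rw [norm_div, norm_pow, hnorm, Complex.norm_natCast]
    rcases n.eq_zero_or_pos with rfl | hn
    · simp
    · exact div_le_self (by positivity) (by exact_mod_cast hn)
  have hcont : ∀ n, Continuous (F n) := fun n => by
    simp only [hF]
    fun_prop
  have hint : ∀ n, Integrable (F n) (α.prod β) := fun n =>
    (integrable_const (r ^ n)).mono' (hcont n).aestronglyMeasurable
      (Eventually.of_forall (hbound n))
  have hsum : Summable fun n => ∫ p, ‖F n p‖ ∂α.prod β := by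
    refine Summable.of_nonneg_of_le (fun n => integral_nonneg fun _ => norm_nonneg _) (fun n => ?_)
      (summable_geometric_of_lt_one hr0 hr)
    calc ∫ p, ‖F n p‖ ∂α.prod β ≤ ∫ _, r ^ n ∂α.prod β :=
          integral_mono (hint n).norm (integrable_const _) (hbound n)
      _ = r ^ n := by simp
  have key := hasSum_integral_of_summable_integral_norm hint hsum
  have h1 : (∫ p, ∑' n, F n p ∂α.prod β) =
      -∫ p, Real.log ‖1 - r * ((p.1⁻¹ * p.2 : Circle) : ℂ)‖ ∂α.prod β := by
    rw [← integral_neg]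
    refine integral_congr_ae (Eventually.of_forall fun p => ?_)
    have := Complex.hasSum_re (Complex.hasSum_taylorSeries_neg_log
      (z := r * ((p.1⁻¹ * p.2 : Circle) : ℂ)) (by rw [hnorm]; exact hr))
    simpa [Complex.log_re, hF] using this.tsum_eq
  rw [h1] at key
  have hcoef : ∀ n : ℕ, ∫ p, F n p ∂α.prod β =
      r ^ n / n * (conj (∫ z, (z : ℂ) ^ n ∂α) * ∫ z, (z : ℂ) ^ n ∂β).re := by
    intro n
    have h2 : ∀ p : Circle × Circle,
        F n p = (((r ^ n / n : ℝ) : ℂ) * (conj ((p.1 : ℂ) ^ n) * (p.2 : ℂ) ^ n)).re := fun p => by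
      simp only [hF]
      rw [map_pow, ← Circle.coe_inv_eq_conj]
      push_cast
      congr 1
      ring
    have h3 : Integrable (fun p : Circle × Circle =>
        ((r ^ n / n : ℝ) : ℂ) * (conj ((p.1 : ℂ) ^ n) * (p.2 : ℂ) ^ n)) (α.prod β) := by
      refine (integrable_const ‖((r ^ n / n : ℝ) : ℂ)‖).mono' ?_ (Eventually.of_forall fun p => ?_)
      · exact Continuous.aestronglyMeasurable (by fun_prop)
      · simp [Circle.norm_coe]
    simp_rw [h2]
    have h4 := integral_re h3
    simp only [RCLike.re_eq_complex_re] at h4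
    have h5 := integral_prod_mul (μ := α) (ν := β) (fun z : Circle => conj ((z : ℂ) ^ n))
      (fun z : Circle => (z : ℂ) ^ n)
    rw [h4, integral_const_mul, Complex.re_ofReal_mul, ← integral_conj]
    exact congrArg (fun c : ℂ => r ^ n / n * c.re) h5
  simp_rw [hcoef] at key
  exact key

/-- A probability measure on the circle is determined by its Fourier coefficients: the negative ones
are conjugates of the positive ones, and trigonometric polynomials are uniformly dense. -/
lemma measure_ext_of_forall_integral_pow_eq {μ ν : Measure Circle} [IsProbabilityMeasure μ]
    [IsProbabilityMeasure ν]
    (h : ∀ n : ℕ, 1 ≤ n → ∫ z, (z : ℂ) ^ n ∂μ = ∫ z, (z : ℂ) ^ n ∂ν) : μ = ν := by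
  have : Fact (0 < 2 * π) := ⟨by positivity⟩
  set e : AddCircle (2 * π) ≃ₜ Circle := AddCircle.homeomorphCircle' with he
  have hz : ∀ n : ℤ, ∫ z, ((z ^ n : Circle) : ℂ) ∂μ = ∫ z, ((z ^ n : Circle) : ℂ) ∂ν := by
    intro n
    rcases lt_trichotomy n 0 with hn | rfl | hn
    · have h1 : ∀ z : Circle, ((z ^ n : Circle) : ℂ) = conj ((z : ℂ) ^ n.natAbs) := fun z => by
        rw [← Circle.coe_pow, ← Circle.coe_inv_eq_conj, ← zpow_natCast, ← zpow_neg]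
        congr 2
        omega
      simp_rw [h1, integral_conj]
      rw [h _ (by omega)]
    · simp
    · obtain ⟨m, rfl⟩ := Int.eq_ofNat_of_zero_le hn.le
      simpa using h m (by omega)
  have hint : ∀ (f : C(AddCircle (2 * π), ℂ)) (ρ : Measure Circle) [IsProbabilityMeasure ρ],
      Integrable (fun z => f (e.symm z)) ρ := fun f ρ _ =>
    (integrable_const ‖f‖).mono' (Continuous.aestronglyMeasurable (by fun_prop))
      (Eventually.of_forall fun z => f.norm_coe_le_norm _)
  have hlip : ∀ (ρ : Measure Circle) [IsProbabilityMeasure ρ],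
      Continuous fun f : C(AddCircle (2 * π), ℂ) => ∫ z, f (e.symm z) ∂ρ := fun ρ _ => by
    refine LipschitzWith.continuous (K := 1) (LipschitzWith.of_dist_le_mul fun f g => ?_)
    rw [dist_eq_norm, ← integral_sub (hint f ρ) (hint g ρ), dist_eq_norm, NNReal.coe_one, one_mul]
    refine (norm_integral_le_of_norm_le_const (C := ‖f - g‖)
      (Eventually.of_forall fun z => (f - g).norm_coe_le_norm (e.symm z))).trans ?_
    simp
  have hall : ∀ f : C(AddCircle (2 * π), ℂ), ∫ z, f (e.symm z) ∂μ = ∫ z, f (e.symm z) ∂ν := by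
    have hclosed : IsClosed {f : C(AddCircle (2 * π), ℂ) |
        ∫ z, f (e.symm z) ∂μ = ∫ z, f (e.symm z) ∂ν} := isClosed_eq (hlip μ) (hlip ν)
    have hsub : ((Submodule.span ℂ (Set.range (@fourier (2 * π))) : Submodule ℂ _) :
        Set C(AddCircle (2 * π), ℂ)) ⊆ {f | ∫ z, f (e.symm z) ∂μ = ∫ z, f (e.symm z) ∂ν} := by
      intro f hf
      induction hf using Submodule.span_induction with
      | mem f hf =>
        obtain ⟨n, rfl⟩ := hf
        have h1 : ∀ z : Circle, fourier n (e.symm z) = ((z ^ n : Circle) : ℂ) := fun z => by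
          obtain ⟨x, rfl⟩ := e.surjective z
          rw [e.symm_apply_apply, fourier_apply, AddCircle.toCircle_zsmul]
          congr 2
          induction x using QuotientAddGroup.induction_on with
          | H x =>
            rw [he, AddCircle.homeomorphCircle'_apply_mk, AddCircle.toCircle_apply_mk]
            congr 1
            field_simp
        simp_rw [Set.mem_ofPred_eq, h1]
        exact hz n
      | zero => simp
      | add f g _ _ hf hg =>
        simp only [Set.mem_ofPred_eq, ContinuousMap.add_apply] at hf hg ⊢
        rw [integral_add (hint f μ) (hint g μ), integral_add (hint f ν) (hint g ν), hf, hg]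
      | smul c f _ hf =>
        simp only [Set.mem_ofPred_eq, ContinuousMap.smul_apply] at hf ⊢
        rw [integral_smul, integral_smul, hf]
    intro f
    have hf : f ∈ (Submodule.span ℂ (Set.range (@fourier (2 * π)))).topologicalClosure := by
      rw [span_fourier_closure_eq_top]
      trivial
    exact hclosed.closure_subset_iff.2 hsub hf
  refine ext_of_forall_integral_eq_of_IsFiniteMeasure fun f => ?_
  have h1 := hall ⟨fun x => ((f (e x) : ℝ) : ℂ), by fun_prop⟩
  simp only [ContinuousMap.coe_mk, e.apply_symm_apply] at h1
  rw [integral_complex_ofReal, integral_complex_ofReal] at h1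
  exact_mod_cast h1

lemma tendsto_integral_log_norm_one_sub_inv_mul {α β : Measure Circle} [IsProbabilityMeasure α]
    [IsProbabilityMeasure β] (hne : ∀ᵐ p ∂α.prod β, p.1 ≠ p.2)
    (hint : Integrable (fun p : Circle × Circle => Real.log ‖(p.1 : ℂ) - p.2‖) (α.prod β)) :
    Tendsto (fun r : ℝ => ∫ p, Real.log ‖1 - r * ((p.1⁻¹ * p.2 : Circle) : ℂ)‖ ∂α.prod β) (𝓝[<] 1)
      (𝓝 (∫ p, Real.log ‖(p.1 : ℂ) - p.2‖ ∂α.prod β)) := by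
  have h := tendsto_integral_log_norm_one_sub (ρ := α.prod β)
    (w := fun p : Circle × Circle => p.1⁻¹ * p.2) (by fun_prop)
    (hne.mono fun p hp h1 => hp (inv_mul_eq_one.1 h1))
    (by simpa only [norm_one_sub_inv_mul] using hint)
  simpa only [norm_one_sub_inv_mul] using h

/-- The logarithmic energy of `ν - μ` dominates every Fourier coefficient of `ν - μ`; in particular
it is nonnegative, and it vanishes only if `ν = μ`. -/
lemma norm_sq_integral_pow_sub_le {μ ν : Measure Circle} [IsProbabilityMeasure μ]
    [IsProbabilityMeasure ν]
    (hne₁ : ∀ᵐ p ∂ν.prod ν, p.1 ≠ p.2) (hne₂ : ∀ᵐ p ∂ν.prod μ, p.1 ≠ p.2)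
    (hne₃ : ∀ᵐ p ∂μ.prod μ, p.1 ≠ p.2)
    (h₁ : Integrable (fun p : Circle × Circle => Real.log ‖(p.1 : ℂ) - p.2‖) (ν.prod ν))
    (h₂ : Integrable (fun p : Circle × Circle => Real.log ‖(p.1 : ℂ) - p.2‖) (ν.prod μ))
    (h₃ : Integrable (fun p : Circle × Circle => Real.log ‖(p.1 : ℂ) - p.2‖) (μ.prod μ)) (n : ℕ) :
    ‖∫ z, (z : ℂ) ^ n ∂ν - ∫ z, (z : ℂ) ^ n ∂μ‖ ^ 2 / n ≤
      -∫ p, Real.log ‖(p.1 : ℂ) - p.2‖ ∂ν.prod ν + 2 * ∫ p, Real.log ‖(p.1 : ℂ) - p.2‖ ∂ν.prod μ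
        - ∫ p, Real.log ‖(p.1 : ℂ) - p.2‖ ∂μ.prod μ := by
  set D : ℕ → ℝ := fun n => ‖∫ z, (z : ℂ) ^ n ∂ν - ∫ z, (z : ℂ) ^ n ∂μ‖ ^ 2 / n
  have hlim := ((tendsto_integral_log_norm_one_sub_inv_mul hne₁ h₁).neg.add
    ((tendsto_integral_log_norm_one_sub_inv_mul hne₂ h₂).const_mul 2)).sub
    (tendsto_integral_log_norm_one_sub_inv_mul hne₃ h₃)
  have hpow : Tendsto (fun r : ℝ => r ^ n * D n) (𝓝[<] 1) (𝓝 (D n)) := by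
    have : ContinuousAt (fun r : ℝ => r ^ n * D n) 1 := by fun_prop
    simpa using this.tendsto.mono_left (nhdsWithin_le_nhds (s := Iio 1))
  refine le_of_tendsto_of_tendsto hpow hlim ?_
  filter_upwards [Ioo_mem_nhdsLT (zero_lt_one' ℝ)] with r hr
  have hs := ((hasSum_neg_integral_log_norm_one_sub ν ν hr.1.le hr.2).sub
    ((hasSum_neg_integral_log_norm_one_sub ν μ hr.1.le hr.2).mul_left 2)).add
    (hasSum_neg_integral_log_norm_one_sub μ μ hr.1.le hr.2)
  have hterm : ∀ m : ℕ, r ^ m / m * (conj (∫ z, (z : ℂ) ^ m ∂ν) * ∫ z, (z : ℂ) ^ m ∂ν).re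
      - 2 * (r ^ m / m * (conj (∫ z, (z : ℂ) ^ m ∂ν) * ∫ z, (z : ℂ) ^ m ∂μ).re)
      + r ^ m / m * (conj (∫ z, (z : ℂ) ^ m ∂μ) * ∫ z, (z : ℂ) ^ m ∂μ).re = r ^ m * D m := by
    intro m
    simp only [D, ← Complex.normSq_eq_norm_sq, Complex.normSq_apply, Complex.mul_re,
      Complex.conj_re, Complex.conj_im, Complex.sub_re, Complex.sub_im]
    ring
  simp_rw [hterm] at hs
  have := le_hasSum hs n fun m _ => mul_nonneg (pow_nonneg hr.1.le m) (by positivity)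
  linarith

/-! ### Minimizers of the weighted energy -/

lemma extIntegral_of_nonneg {α : Type*} [MeasurableSpace α] {μ : Measure α} {f : α → EReal}
    (hf : ∀ a, 0 ≤ f a) : extIntegral μ f = ((∫⁻ a, (f a).toENNReal ∂μ : ENNReal) : EReal) := by
  have : ∀ a, (-f a).toENNReal = 0 := fun a =>
    EReal.toENNReal_of_nonpos (EReal.neg_le_of_neg_le (by simpa using hf a))
  simp [extIntegral, this]

/-- A probability measure for which the logarithmic kernel has a finite double integral does not
charge the diagonal, and the real-valued kernel is integrable. -/
lemma ae_ne_and_integrable_of_lintegral_ne_top {ρ : Measure (Circle × Circle)} [IsFiniteMeasure ρ]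
    (h : ∫⁻ p, (-logDist p.1 p.2).toENNReal ∂ρ ≠ ⊤) :
    (∀ᵐ p ∂ρ, p.1 ≠ p.2) ∧
      Integrable (fun p : Circle × Circle => Real.log ‖(p.1 : ℂ) - p.2‖) ρ := by
  have hmeas : Measurable fun p : Circle × Circle => (-logDist p.1 p.2).toENNReal :=
    (measurable_logDist.neg).ereal_toENNReal
  have hne : ∀ᵐ p ∂ρ, p.1 ≠ p.2 := by
    filter_upwards [ae_lt_top hmeas h] with p hp heq
    rw [heq, logDist_self, EReal.neg_bot, EReal.toENNReal_top] at hp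
    exact lt_irrefl _ hp
  refine ⟨hne, ?_⟩
  have h1 : Integrable (fun p => ((-logDist p.1 p.2).toENNReal).toReal) ρ :=
    integrable_toReal_of_lintegral_ne_top hmeas.aemeasurable h
  refine (h1.add (integrable_const (Real.log 2))).mono'
    measurable_log_norm_coe_sub.aestronglyMeasurable ?_
  filter_upwards [hne] with p hp
  have h2 := log_norm_coe_sub_le p.1 p.2
  have h3 : 0 ≤ Real.log 2 := by positivity
  rw [Pi.add_apply, logDist_of_ne hp, ← EReal.coe_neg, EReal.real_coe_toENNReal,
    ENNReal.toReal_ofReal', Real.norm_eq_abs, abs_le]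
  constructor
  · linarith [le_max_left (-Real.log ‖(p.1 : ℂ) - p.2‖) 0]
  · linarith [le_max_right (-Real.log ‖(p.1 : ℂ) - p.2‖) 0]

lemma ae_prod_ne {μ ν : Measure Circle} [IsProbabilityMeasure μ] [IsProbabilityMeasure ν]
    [NullSingletonClass μ] : ∀ᵐ p ∂ν.prod μ, p.1 ≠ p.2 := by
  have hm : MeasurableSet {p : Circle × Circle | p.1 ≠ p.2} :=
    (isClosed_eq continuous_fst continuous_snd).measurableSet.compl
  rw [Measure.ae_prod_iff_ae_ae hm]
  refine Eventually.of_forall fun z => ?_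
  filter_upwards [compl_mem_ae_iff.2 (measure_singleton (μ := μ) z)] with s hs h
  exact hs h.symm

/-- A bounded logarithmic potential makes the kernel integrable against every product measure. -/
lemma integrable_log_prod {μ ν : Measure Circle} [IsProbabilityMeasure μ] [IsProbabilityMeasure ν]
    (hint : ∀ z : Circle, Integrable (fun s : Circle => Real.log ‖(z : ℂ) - s‖) μ) {C : ℝ}
    (hC : ∀ z : Circle, |∫ s : Circle, Real.log ‖(z : ℂ) - s‖ ∂μ| ≤ C) :
    Integrable (fun p : Circle × Circle => Real.log ‖(p.1 : ℂ) - p.2‖) (ν.prod μ) := by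
  have hm : AEStronglyMeasurable (fun p : Circle × Circle => Real.log ‖(p.1 : ℂ) - p.2‖)
    (ν.prod μ) := measurable_log_norm_coe_sub.aestronglyMeasurable
  rw [integrable_prod_iff hm]
  refine ⟨Eventually.of_forall hint, ?_⟩
  refine (integrable_const (2 * Real.log 2 + C)).mono' hm.norm.integral_prod_right'
    (Eventually.of_forall fun z => ?_)
  rw [Real.norm_of_nonneg (integral_nonneg fun _ => norm_nonneg _)]
  calc ∫ s : Circle, ‖Real.log ‖(z : ℂ) - s‖‖ ∂μ
      ≤ ∫ s : Circle, (2 * Real.log 2 - Real.log ‖(z : ℂ) - s‖) ∂μ :=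
        integral_mono (hint z).norm ((integrable_const _).sub (hint z))
          fun s => abs_log_norm_coe_sub_le z s
    _ = 2 * Real.log 2 - ∫ s : Circle, Real.log ‖(z : ℂ) - s‖ ∂μ := by
        rw [integral_sub (integrable_const _) (hint z)]
        simp
    _ ≤ 2 * Real.log 2 + C := by linarith [neg_le_of_abs_le (hC z)]

/-- **Sufficiency of the variational conditions.** If the potential of `μ` is bounded, and
`2 ∫ log |z - s| dμ(s) + ℓ` is at most `V` everywhere and equal to `V` almost everywhere for `μ`,
then `μ` is the only minimizer of the weighted energy. The inequality is written without
subtraction, so that it makes sense where `V = +∞`. -/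
theorem isEquilibriumMeasure_iff_eq {V : Circle → EReal} (hVm : Measurable V) (hV0 : ∀ z, 0 ≤ V z)
    {μ : Measure Circle} [IsProbabilityMeasure μ] [NullSingletonClass μ] {ℓ C : ℝ}
    (hint : ∀ z : Circle, Integrable (fun s : Circle => Real.log ‖(z : ℂ) - s‖) μ)
    (hC : ∀ z : Circle, |∫ s : Circle, Real.log ‖(z : ℂ) - s‖ ∂μ| ≤ C)
    (hle : ∀ z : Circle, ((2 * ∫ s : Circle, Real.log ‖(z : ℂ) - s‖ ∂μ + ℓ : ℝ) : EReal) ≤ V z)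
    (heq : ∀ᵐ z : Circle ∂μ,
      V z = ((2 * ∫ s : Circle, Real.log ‖(z : ℂ) - s‖ ∂μ + ℓ : ℝ) : EReal))
    (ν : Measure Circle) : IsEquilibriumMeasure V ν ↔ ν = μ := by
  set P : Circle → ℝ := fun z => ∫ s : Circle, Real.log ‖(z : ℂ) - s‖ ∂μ with hP
  have hPm : StronglyMeasurable P := by
    have := (measurable_log_norm_coe_sub.stronglyMeasurable).integral_prod_right' (ν := μ)
    exact this
  have hPint : ∀ (ρ : Measure Circle) [IsProbabilityMeasure ρ], Integrable P ρ := fun ρ _ =>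
    (integrable_const C).mono' hPm.aestronglyMeasurable (Eventually.of_forall hC)
  have hprod : ∀ (ρ : Measure Circle) [IsProbabilityMeasure ρ],
      Integrable (fun p : Circle × Circle => Real.log ‖(p.1 : ℂ) - p.2‖) (ρ.prod μ) :=
    fun ρ _ => integrable_log_prod hint hC
  have hfub : ∀ (ρ : Measure Circle) [IsProbabilityMeasure ρ],
      ∫ p, Real.log ‖(p.1 : ℂ) - p.2‖ ∂ρ.prod μ = ∫ z, P z ∂ρ :=
    fun ρ _ => integral_prod _ (hprod ρ)
  -- the energy of a measure with finite kernel and field integrals, in real terms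
  have henergy : ∀ (ρ : Measure Circle) [IsProbabilityMeasure ρ] (v : Circle → ℝ),
      (∀ᵐ p ∂ρ.prod ρ, p.1 ≠ p.2) →
      Integrable (fun p : Circle × Circle => Real.log ‖(p.1 : ℂ) - p.2‖) (ρ.prod ρ) →
      Integrable v ρ → (∀ᵐ z ∂ρ, V z = (v z : EReal)) →
      energy V ρ = ((-∫ p, Real.log ‖(p.1 : ℂ) - p.2‖ ∂ρ.prod ρ + ∫ z, v z ∂ρ : ℝ) : EReal) := by
    intro ρ _ v hne hlog hv hVv
    rw [energy, coe_extIntegral hv hVv, EReal.coe_add, ← integral_neg]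
    congr 1
    refine coe_extIntegral hlog.neg (hne.mono fun p hp => ?_)
    rw [logDist_of_ne hp]
    rfl
  have hμ : energy V μ = ((∫ z, P z ∂μ + ℓ : ℝ) : EReal) := by
    rw [henergy μ (fun z => 2 * P z + ℓ) ae_prod_ne (hprod μ)
      (((hPint μ).const_mul 2).add (integrable_const ℓ)) heq, hfub,
      integral_add ((hPint μ).const_mul 2) (integrable_const ℓ), integral_const_mul]
    congr 1
    simp
    ring
  -- a competitor either has infinite energy or is governed by the positivity of the energy
  have hcase : ∀ (ρ : Measure Circle) [IsProbabilityMeasure ρ], energy V ρ = ⊤ ∨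
      ∃ e : ℝ, energy V ρ = (e : EReal) ∧
        ∀ n : ℕ, ‖∫ z, (z : ℂ) ^ n ∂ρ - ∫ z, (z : ℂ) ^ n ∂μ‖ ^ 2 / n ≤ e - (∫ z, P z ∂μ + ℓ) := by
    intro ρ _
    have hneg : ∫⁻ p, (-(-logDist p.1 p.2)).toENNReal ∂ρ.prod ρ ≠ ⊤ := by
      refine ((lintegral_mono (g := fun _ => ENNReal.ofReal (Real.log 2)) fun p => ?_).trans_lt
        (by simp)).ne
      by_cases hp : p.1 = p.2
      · simp [hp, logDist_self]
      · rw [neg_neg, logDist_of_ne hp, EReal.real_coe_toENNReal]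
        exact ENNReal.ofReal_le_ofReal (log_norm_coe_sub_le _ _)
    by_cases hK : ∫⁻ p, (-logDist p.1 p.2).toENNReal ∂ρ.prod ρ = ⊤
    · left
      rw [energy, extIntegral_of_nonneg hV0, extIntegral, hK, EReal.coe_ennreal_top,
        EReal.top_sub (by simpa using hneg), EReal.top_add_of_ne_bot (EReal.coe_ennreal_ne_bot _)]
    obtain ⟨hne, hlog⟩ := ae_ne_and_integrable_of_lintegral_ne_top hK
    by_cases hVi : ∫⁻ z, (V z).toENNReal ∂ρ = ⊤
    · left
      have hcoe : extIntegral (ρ.prod ρ) (fun p => -logDist p.1 p.2) =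
          ((∫ p, -Real.log ‖(p.1 : ℂ) - p.2‖ ∂ρ.prod ρ : ℝ) : EReal) :=
        coe_extIntegral hlog.neg (hne.mono fun p hp => by rw [logDist_of_ne hp]; rfl)
      rw [energy, extIntegral_of_nonneg hV0, hVi, hcoe, EReal.coe_ennreal_top, EReal.coe_add_top]
    right
    have hVm' : Measurable fun z => (V z).toENNReal := hVm.ereal_toENNReal
    set v : Circle → ℝ := fun z => (V z).toENNReal.toReal with hv
    have hvint : Integrable v ρ := integrable_toReal_of_lintegral_ne_top hVm'.aemeasurable hVi
    have hVv : ∀ᵐ z ∂ρ, V z = (v z : EReal) := by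
      filter_upwards [ae_lt_top hVm' hVi] with z hz
      rw [hv, EReal.coe_ennreal_toReal hz.ne, EReal.coe_toENNReal (hV0 z)]
    refine ⟨_, henergy ρ v hne hlog hvint hVv, fun n => ?_⟩
    have h1 := norm_sq_integral_pow_sub_le hne ae_prod_ne ae_prod_ne hlog (hprod ρ) (hprod μ) n
    rw [hfub ρ, hfub μ] at h1
    -- the field of the competitor is at least the affine function of the potential of `μ`
    have h2 : ∫ z, (2 * P z + ℓ) ∂ρ ≤ ∫ z, v z ∂ρ := by
      refine integral_mono_ae (((hPint ρ).const_mul 2).add (integrable_const ℓ)) hvint ?_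
      filter_upwards [hVv] with z hz
      have := hle z
      rw [hz] at this
      exact_mod_cast this
    rw [integral_add ((hPint ρ).const_mul 2) (integrable_const ℓ), integral_const_mul] at h2
    simp only [integral_const, probReal_univ, smul_eq_mul, one_mul] at h2
    linarith
  constructor
  · rintro ⟨hν, hmin⟩
    have h1 := hmin μ inferInstance
    rcases hcase ν with htop | ⟨e, he, hn⟩
    · rw [htop, hμ] at h1
      exact absurd (top_le_iff.1 h1) (EReal.coe_ne_top _)
    · rw [he, hμ, EReal.coe_le_coe_iff] at h1
      refine measure_ext_of_forall_integral_pow_eq fun n hn1 => ?_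
      have h2 := (hn n).trans (sub_nonpos.2 h1)
      have hn0 : (0 : ℝ) < n := by exact_mod_cast hn1
      rw [div_le_iff₀ hn0, zero_mul] at h2
      have h3 := pow_eq_zero_iff (two_ne_zero) |>.1 (le_antisymm h2 (by positivity))
      exact sub_eq_zero.1 (norm_eq_zero.1 h3)
  · rintro rfl
    refine ⟨inferInstance, fun ρ hρ => ?_⟩
    -- nonnegativity of the energy gap needs only one Fourier coefficient
    rcases hcase ρ with htop | ⟨e, he, hn⟩
    · rw [htop]
      exact le_top
    · rw [he, hμ, EReal.coe_le_coe_iff]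
      have := hn 1
      have h2 : (0 : ℝ) ≤ ‖∫ z, (z : ℂ) ^ 1 ∂ρ - ∫ z, (z : ℂ) ^ 1 ∂ν‖ ^ 2 / (1 : ℕ) := by positivity
      linarith

/-! ### The Herglotz formula -/

/-- The Herglotz formula: a holomorphic function, real at `0`, from the boundary values of its real
part. With `k` the kernel, `k Re f = Re k f - i Im (conj k f)`; the first term has average `f z` by
Poisson's formula, and `conj k f` has average `f 0` by the mean value property. -/
lemma circleAverage_herglotz_mul_re {f : ℂ → ℂ} (hf : DiffContOnCl ℂ f (Metric.ball 0 1)) {z : ℂ}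
    (hz : ‖z‖ < 1) (h0 : (f 0).im = 0) :
    circleAverage (fun w => (w + z) / (w - z) * ((f w).re : ℂ)) 0 1 = f z := by
  have hzb : z ∈ Metric.ball (0 : ℂ) 1 := by simpa using hz
  have hfs : ContinuousOn f (Metric.sphere 0 1) := by
    refine hf.2.mono ?_
    rw [closure_ball _ one_ne_zero]
    exact Metric.sphere_subset_closedBall
  have hsub : ∀ w ∈ Metric.sphere (0 : ℂ) 1, w - z ≠ 0 := fun w hw h => by
    rw [mem_sphere_zero_iff_norm] at hw
    rw [sub_eq_zero.1 h] at hw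
    linarith
  have hden : ∀ w : ℂ, ‖w‖ ≤ 1 → 1 - conj z * w ≠ 0 := fun w hw h => by
    have h1 : ‖conj z * w‖ = 1 := by rw [← sub_eq_zero.1 h, norm_one]
    rw [norm_mul, Complex.norm_conj] at h1
    nlinarith [norm_nonneg z, norm_nonneg w]
  have hkc : ContinuousOn (fun w => (w + z) / (w - z)) (Metric.sphere 0 1) :=
    ContinuousOn.div (by fun_prop) (by fun_prop) hsub
  have h1 : circleAverage (fun w => ((w + z) / (w - z)).re • f w) 0 1 = f z := by
    simpa using hf.circleAverage_re_herglotzRieszKernel_smul' hzb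
  -- on the unit circle the conjugate of the kernel extends to a holomorphic function
  have h2 : circleAverage (fun w => conj ((w + z) / (w - z)) * f w) 0 1 = f 0 := by
    have hd : DiffContOnCl ℂ (fun w => (1 + conj z * w) / (1 - conj z * w) * f w)
        (Metric.ball 0 |1|) := by
      rw [abs_one]
      refine DiffContOnCl.smul (𝕜' := ℂ) ?_ hf
      refine DifferentiableOn.diffContOnCl ?_
      rw [closure_ball _ one_ne_zero]
      intro w hw
      have h := hden w (by simpa using hw)
      generalize conj z = k at h ⊢
      have hdk : DifferentiableAt ℂ (fun w : ℂ => (1 + k * w) / (1 - k * w)) w :=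
        DifferentiableAt.div (by fun_prop) (by fun_prop) h
      exact hdk.differentiableWithinAt
    have h3 := hd.circleAverage
    rw [mul_zero, add_zero, sub_zero, div_one, one_mul] at h3
    rw [← h3]
    refine circleAverage_congr_sphere fun w hw => ?_
    rw [abs_one, mem_sphere_zero_iff_norm] at hw
    have hw0 : w ≠ 0 := fun h => by simp [h] at hw
    have hconj : conj w = w⁻¹ := by
      rw [Complex.inv_def, Complex.normSq_eq_norm_sq, hw]
      simp
    have h4 := hden w hw.le
    have h5 : w⁻¹ - conj z ≠ 0 := fun h => h4 (by
      rw [← sub_eq_zero.1 h, inv_mul_cancel₀ hw0, sub_self])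
    simp only [map_div₀, map_add, map_sub, hconj]
    congr 1
    rw [div_eq_div_iff h5 h4]
    field_simp
  have hc1 : CircleIntegrable (fun w => ((w + z) / (w - z)).re • f w) 0 1 := by
    refine ContinuousOn.circleIntegrable zero_le_one ?_
    exact (Complex.continuous_re.comp_continuousOn hkc).smul hfs
  have hc2 : CircleIntegrable (fun w => conj ((w + z) / (w - z)) * f w) 0 1 := by
    refine ContinuousOn.circleIntegrable zero_le_one ?_
    exact (Complex.continuous_conj.comp_continuousOn hkc).mul hfs
  have hc3 : CircleIntegrable
      (fun w => (((conj ((w + z) / (w - z)) * f w).im : ℝ) : ℂ) * Complex.I) 0 1 := by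
    refine ContinuousOn.circleIntegrable zero_le_one ?_
    exact (Complex.continuous_ofReal.comp_continuousOn (Complex.continuous_im.comp_continuousOn
      ((Complex.continuous_conj.comp_continuousOn hkc).mul hfs))).mul continuousOn_const
  have h3 : circleAverage (fun w => (((conj ((w + z) / (w - z)) * f w).im : ℝ) : ℂ) * Complex.I)
      0 1 = 0 := by
    have h4 := ((Complex.ofRealCLM.comp Complex.imCLM).smulRight Complex.I).circleAverage_comp_comm
      hc2
    rw [h2] at h4
    simpa [h0, Function.comp_def] using h4
  calc circleAverage (fun w => (w + z) / (w - z) * ((f w).re : ℂ)) 0 1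
      = circleAverage (fun w => ((w + z) / (w - z)).re • f w -
          (((conj ((w + z) / (w - z)) * f w).im : ℝ) : ℂ) * Complex.I) 0 1 := by
        congr 1
        ext w
        generalize (w + z) / (w - z) = k
        apply Complex.ext <;> simp
    _ = f z := by
        rw [circleAverage_fun_sub hc1 hc3, h1, h3, sub_zero]

/-! ### The branch of the square root in the disc -/

/-- The quotient `(z² + 2az + 1) / (z² - 2cz + 1)`. -/
noncomputable def discRatio (a c : ℝ) (z : ℂ) : ℂ :=
  (z ^ 2 + 2 * a * z + 1) / (z ^ 2 - 2 * c * z + 1)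

/-- The principal branch of `√((z² + 2az + 1) / (z² - 2cz + 1))`. -/
noncomputable def discRoot (a c : ℝ) (z : ℂ) : ℂ := (discRatio a c z).sqrt

/-- The boundary values of `discRatio` on the unit circle, which are real. -/
noncomputable def circleRatio (a c θ : ℝ) : ℝ := (Real.cos θ + a) / (Real.cos θ - c)

lemma quad_eq_mul (φ : ℝ) (z : ℂ) : z ^ 2 - 2 * (Real.cos φ : ℝ) * z + 1 =
    (z - Circle.exp φ) * (z - Circle.exp (-φ)) := by
  have h1 : (Circle.exp φ : ℂ) * Circle.exp (-φ) = 1 := by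
    rw [← Circle.coe_mul, ← Circle.exp_add]
    simp
  have h2 : (Circle.exp φ : ℂ) + Circle.exp (-φ) = 2 * (Real.cos φ : ℝ) := by
    rw [Circle.coe_exp, Circle.coe_exp, Complex.ofReal_cos, Complex.two_cos]
    push_cast
    rfl
  linear_combination z * h2 - h1

lemma quad_ne_zero {c : ℝ} (hc : -1 ≤ c) (hc' : c ≤ 1) {z : ℂ} (hz : ‖z‖ < 1) :
    z ^ 2 - 2 * c * z + 1 ≠ 0 := by
  rw [← Real.cos_arccos hc hc', quad_eq_mul]
  have h : ∀ s : Circle, z - s ≠ 0 := fun s hs => by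
    rw [sub_eq_zero.1 hs, Circle.norm_coe] at hz
    exact lt_irrefl _ hz
  exact mul_ne_zero (h _) (h _)

lemma quad_circle (a θ : ℝ) : (Circle.exp θ : ℂ) ^ 2 + 2 * a * Circle.exp θ + 1 =
    2 * ((Real.cos θ + a : ℝ) : ℂ) * Circle.exp θ := by
  have h := quad_eq_mul θ (Circle.exp θ)
  rw [sub_self, zero_mul] at h
  push_cast at h ⊢
  linear_combination h

/-- The denominator is bounded below, uniformly on concentric circles, by its value at the boundary
point of the same argument. -/
lemma abs_cos_sub_le_norm_quad {c : ℝ} (hc : -1 ≤ c) (hc' : c ≤ 1) {r : ℝ} (hr0 : 0 ≤ r)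
    (hr : r ≤ 1) (θ : ℝ) : |Real.cos θ - c| / 2 ≤
      ‖(r * Circle.exp θ : ℂ) ^ 2 - 2 * c * (r * Circle.exp θ) + 1‖ := by
  have h1 : ∀ s : Circle, ‖(Circle.exp θ : ℂ) - s‖ ≤ 2 * ‖(r * Circle.exp θ : ℂ) - s‖ := fun s => by
    have h2 := norm_one_sub_le_two_mul hr0 hr (Circle.exp θ * s⁻¹)
    have h3 : ∀ x : ℂ, ‖1 - x * ((Circle.exp θ * s⁻¹ : Circle) : ℂ)‖ = ‖x * Circle.exp θ - s‖ := by
      intro x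
      have : x * Circle.exp θ - s = -(s * (1 - x * ((Circle.exp θ * s⁻¹ : Circle) : ℂ))) := by
        push_cast
        field_simp [s.coe_ne_zero]
        ring
      rw [this, norm_neg, norm_mul, Circle.norm_coe, one_mul]
    have h4 := h3 1
    rw [one_mul, one_mul] at h4
    rwa [h4, h3] at h2
  have h5 := quad_circle (-c) θ
  have h6 : (Circle.exp θ : ℂ) ^ 2 - 2 * c * Circle.exp θ + 1 =
      2 * ((Real.cos θ - c : ℝ) : ℂ) * Circle.exp θ := by
    push_cast at h5 ⊢
    linear_combination h5
  have h7 := congrArg norm h6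
  rw [norm_mul, norm_mul, Circle.norm_coe, Complex.norm_real, Real.norm_eq_abs, RCLike.norm_two,
    mul_one] at h7
  rw [← Real.cos_arccos hc hc'] at h7 ⊢
  have h8 := quad_eq_mul (Real.arccos c) (Circle.exp θ)
  have h9 := quad_eq_mul (Real.arccos c) (r * Circle.exp θ)
  rw [h8, norm_mul] at h7
  rw [h9, norm_mul]
  have := mul_le_mul (h1 (Circle.exp (Real.arccos c))) (h1 (Circle.exp (-Real.arccos c)))
    (norm_nonneg _) (by positivity)
  linarith

lemma norm_discRatio_le {a c : ℝ} (ha : -1 ≤ a) (ha' : a ≤ 1) (hc : -1 ≤ c) (hc' : c ≤ 1) {r : ℝ}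
    (hr0 : 0 ≤ r) (hr : r ≤ 1) {θ : ℝ} (hθ : Real.cos θ ≠ c) :
    ‖discRatio a c (r * Circle.exp θ)‖ ≤ 8 / |Real.cos θ - c| := by
  have h0 : 0 < |Real.cos θ - c| := abs_pos.2 (sub_ne_zero.2 hθ)
  have hz : ‖(r * Circle.exp θ : ℂ)‖ ≤ 1 := by
    rw [norm_mul, Circle.norm_coe, Complex.norm_real, Real.norm_of_nonneg hr0, mul_one]
    exact hr
  have h1 : ‖(r * Circle.exp θ : ℂ) ^ 2 + 2 * a * (r * Circle.exp θ) + 1‖ ≤ 4 := by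
    generalize (r * Circle.exp θ : ℂ) = z at hz ⊢
    have h2 : |a| ≤ 1 := abs_le.2 ⟨ha, ha'⟩
    calc ‖z ^ 2 + 2 * a * z + 1‖ ≤ ‖z ^ 2‖ + ‖2 * a * z‖ + ‖(1 : ℂ)‖ := norm_add₃_le
      _ = ‖z‖ ^ 2 + 2 * |a| * ‖z‖ + 1 := by simp
      _ ≤ 4 := by nlinarith [norm_nonneg z, abs_nonneg a]
  rw [discRatio, norm_div]
  calc _ ≤ 4 / (|Real.cos θ - c| / 2) :=
        div_le_div₀ (by norm_num) h1 (by positivity) (abs_cos_sub_le_norm_quad hc hc' hr0 hr θ)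
    _ = 8 / |Real.cos θ - c| := by field_simp; norm_num

lemma tendsto_discRatio {a c : ℝ} {θ : ℝ} (hθ : Real.cos θ ≠ c) :
    Tendsto (fun r : ℝ => discRatio a c (r * Circle.exp θ)) (𝓝[<] 1)
      (𝓝 (circleRatio a c θ : ℂ)) := by
  have h1 : (Circle.exp θ : ℂ) ^ 2 - 2 * c * Circle.exp θ + 1 =
      2 * ((Real.cos θ - c : ℝ) : ℂ) * Circle.exp θ := by
    have := quad_circle (-c) θ
    push_cast at this ⊢
    linear_combination this
  have h2 : ((Real.cos θ - c : ℝ) : ℂ) ≠ 0 := by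
    exact_mod_cast sub_ne_zero.2 hθ
  have h3 : (Circle.exp θ : ℂ) ≠ 0 := Circle.coe_ne_zero _
  have hc : ContinuousAt (fun r : ℝ => discRatio a c (r * Circle.exp θ)) 1 := by
    refine ContinuousAt.div (by fun_prop) (by fun_prop) ?_
    rw [Complex.ofReal_one, one_mul, h1]
    exact mul_ne_zero (mul_ne_zero two_ne_zero h2) h3
  have h4 := hc.tendsto.mono_left (nhdsWithin_le_nhds (s := Iio 1))
  rw [Complex.ofReal_one, one_mul] at h4
  convert h4 using 2
  rw [discRatio, quad_circle, h1, circleRatio, Complex.ofReal_div]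
  field_simp

lemma im_discRatio {a c : ℝ} (hc : -1 ≤ c) (hc' : c ≤ 1) {z : ℂ} (hz : ‖z‖ < 1) :
    (discRatio a c z).im =
      2 * (a + c) * z.im * (1 - ‖z‖ ^ 2) / Complex.normSq (z ^ 2 - 2 * c * z + 1) := by
  have h0 := Complex.normSq_pos.2 (quad_ne_zero hc hc' hz)
  rw [discRatio, Complex.div_im, ← Complex.normSq_eq_norm_sq, ← sub_div]
  congr 1
  simp [Complex.normSq_apply, pow_two]
  ring

/-- In the disc the quotient is not real unless `z` is, by `im_discRatio`, and it is positive for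
real `z`. -/
lemma discRatio_mem_slitPlane {a c : ℝ} (ha' : a ≤ 1) (hc' : c < 1) (hac : 0 < a + c) {z : ℂ}
    (hz : ‖z‖ < 1) : discRatio a c z ∈ Complex.slitPlane := by
  have hc : -1 ≤ c := by linarith
  have h0 := Complex.normSq_pos.2 (quad_ne_zero hc hc'.le hz)
  by_cases him : z.im = 0
  · left
    have hzr : z = (z.re : ℂ) := by apply Complex.ext <;> simp [him]
    have hx : |z.re| < 1 := (Complex.abs_re_le_norm z).trans_lt hz
    rw [abs_lt] at hx
    have hR : discRatio a c z =
        (((z.re ^ 2 + 2 * a * z.re + 1) / (z.re ^ 2 - 2 * c * z.re + 1) : ℝ) : ℂ) := by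
      rw [discRatio, hzr]
      push_cast
      simp
    rw [hR, Complex.ofReal_re]
    have hx1 : 0 < (1 + z.re) ^ 2 := pow_pos (by linarith) 2
    have hx2 : 0 < (1 - z.re) ^ 2 := pow_pos (by linarith) 2
    have h1 : 0 < 1 + a := by linarith
    have h2 : 0 < 1 - c := by linarith
    have h3 : 0 ≤ 1 + c := by linarith
    have h4 : 0 ≤ 1 - a := by linarith
    apply div_pos
    · nlinarith [mul_pos h1 hx1, mul_nonneg h4 hx2.le]
    · nlinarith [mul_pos h2 hx1, mul_nonneg h3 hx2.le]
  · right
    rw [im_discRatio hc hc'.le hz]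
    have h1 : 0 < 1 - ‖z‖ ^ 2 := by nlinarith [norm_nonneg z]
    exact div_ne_zero (mul_ne_zero (mul_ne_zero (by positivity) him) h1.ne') h0.ne'

lemma differentiableAt_discRoot {a c : ℝ} (ha' : a ≤ 1) (hc' : c < 1) (hac : 0 < a + c) {z : ℂ}
    (hz : ‖z‖ < 1) : DifferentiableAt ℂ (discRoot a c) z := by
  refine (Complex.differentiableAt_sqrt (discRatio_mem_slitPlane ha' hc' hac hz)).comp z ?_
  exact DifferentiableAt.div (by fun_prop) (by fun_prop) (quad_ne_zero (by linarith) hc'.le hz)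

lemma discRoot_zero (a c : ℝ) : discRoot a c 0 = 1 := by
  simp [discRoot, discRatio]

lemma re_discRoot (a c : ℝ) (z : ℂ) :
    (discRoot a c z).re = √((‖discRatio a c z‖ + (discRatio a c z).re) / 2) := by
  rw [discRoot, Complex.sqrt_eq_real_add_ite]
  split_ifs <;> simp

lemma im_discRoot (a c : ℝ) (z : ℂ) : (discRoot a c z).im =
    (if 0 ≤ (discRatio a c z).im then 1 else -1) *
      √((‖discRatio a c z‖ - (discRatio a c z).re) / 2) := by
  rw [discRoot, Complex.sqrt_eq_real_add_ite]
  split_ifs <;> simp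

lemma abs_re_discRoot_le (a c : ℝ) (z : ℂ) : |(discRoot a c z).re| ≤ √‖discRatio a c z‖ := by
  rw [re_discRoot, abs_of_nonneg (Real.sqrt_nonneg _)]
  exact Real.sqrt_le_sqrt (by linarith [Complex.re_le_norm (discRatio a c z)])

lemma abs_im_discRoot_le (a c : ℝ) (z : ℂ) : |(discRoot a c z).im| ≤ √‖discRatio a c z‖ := by
  have h : |(discRoot a c z).im| = √((‖discRatio a c z‖ - (discRatio a c z).re) / 2) := by
    rw [im_discRoot]
    split_ifs
    · rw [one_mul, abs_of_nonneg (Real.sqrt_nonneg _)]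
    · rw [neg_one_mul, abs_neg, abs_of_nonneg (Real.sqrt_nonneg _)]
  rw [h]
  exact Real.sqrt_le_sqrt (by linarith [(abs_le.1 (Complex.abs_re_le_norm (discRatio a c z))).1])

lemma sqrt_half_abs_add (x : ℝ) : √((|x| + x) / 2) = √x := by
  rcases le_total 0 x with h | h
  · rw [abs_of_nonneg h]; congr 1; ring
  · rw [abs_of_nonpos h, Real.sqrt_eq_zero_of_nonpos h]; simp

/-- Radial limits of the real part. Off the arcs the limit is `0`, the value of `√` at a negative
number. -/
lemma tendsto_re_discRoot {a c : ℝ} {θ : ℝ} (hθ : Real.cos θ ≠ c) :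
    Tendsto (fun r : ℝ => (discRoot a c (r * Circle.exp θ)).re) (𝓝[<] 1)
      (𝓝 √(circleRatio a c θ)) := by
  have h := tendsto_discRatio (a := a) hθ
  have h1 := (((h.norm).add ((Complex.continuous_re.tendsto _).comp h)).div_const 2).sqrt
  rw [Complex.norm_real, Real.norm_eq_abs, Complex.ofReal_re, sqrt_half_abs_add] at h1
  refine h1.congr fun r => ?_
  rw [re_discRoot]
  rfl

/-- Radial limits of the imaginary part on the upper half circle, where the quotient is approached
from the closed upper half plane. On the arcs the limit is `0`. -/
lemma tendsto_im_discRoot {a c : ℝ} (hc : -1 ≤ c) (hc' : c ≤ 1) (hac : 0 ≤ a + c) {θ : ℝ}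
    (hθ : Real.cos θ ≠ c) (h0 : 0 ≤ θ) (hπ : θ ≤ π) :
    Tendsto (fun r : ℝ => (discRoot a c (r * Circle.exp θ)).im) (𝓝[<] 1)
      (𝓝 √(-circleRatio a c θ)) := by
  have h := tendsto_discRatio (a := a) hθ
  have h1 := (((h.norm).sub ((Complex.continuous_re.tendsto _).comp h)).div_const 2).sqrt
  rw [Complex.norm_real, Real.norm_eq_abs, Complex.ofReal_re, sub_eq_add_neg,
    ← abs_neg (circleRatio a c θ), sqrt_half_abs_add] at h1
  refine h1.congr' ?_
  filter_upwards [Ioo_mem_nhdsLT (zero_lt_one' ℝ)] with r hr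
  have hz : ‖(r * Circle.exp θ : ℂ)‖ < 1 := by
    rw [norm_mul, Circle.norm_coe, Complex.norm_real, Real.norm_of_nonneg hr.1.le, mul_one]
    exact hr.2
  have him : 0 ≤ (discRatio a c (r * Circle.exp θ)).im := by
    rw [im_discRatio hc hc' hz]
    have h2 : 0 ≤ (r * Circle.exp θ : ℂ).im := by
      rw [Complex.im_ofReal_mul, Circle.coe_exp, Complex.exp_ofReal_mul_I_im]
      exact mul_nonneg hr.1.le (Real.sin_nonneg_of_nonneg_of_le_pi h0 hπ)
    have h3 : 0 ≤ 1 - ‖(r * Circle.exp θ : ℂ)‖ ^ 2 := by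
      nlinarith [norm_nonneg (r * Circle.exp θ : ℂ)]
    exact div_nonneg (mul_nonneg (mul_nonneg (by positivity) h2) h3) (Complex.normSq_nonneg _)
  rw [im_discRoot, if_pos him, one_mul]
  rfl

lemma im_discRoot_conj {a c : ℝ} (ha' : a ≤ 1) (hc' : c < 1) (hac : 0 < a + c) {z : ℂ}
    (hz : ‖z‖ < 1) : (discRoot a c (conj z)).im = -(discRoot a c z).im := by
  have h1 : discRatio a c (conj z) = conj (discRatio a c z) := by
    simp [discRatio, map_ofNat]
  have h2 := Complex.slitPlane_arg_ne_pi (discRatio_mem_slitPlane ha' hc' hac hz)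
  rw [discRoot, h1, Complex.sqrt, Complex.conj_cpow _ _ h2]
  simp [discRoot, Complex.sqrt, map_ofNat]

/-! ### The logarithmic potential of a measure with given Herglotz transform -/

lemma norm_ofReal_mul_circle_lt_one {r : ℝ} (hr0 : 0 ≤ r) (hr : r < 1) (w : Circle) :
    ‖(r * (w : ℂ))‖ < 1 := by
  rwa [norm_mul, Circle.norm_coe, Complex.norm_real, Real.norm_of_nonneg hr0, mul_one]

lemma one_sub_norm_le_norm_sub (s : Circle) (z : ℂ) : 1 - ‖z‖ ≤ ‖(s : ℂ) - z‖ := by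
  have h := norm_sub_norm_le (s : ℂ) z
  rwa [Circle.norm_coe] at h

/-- The holomorphic function `∫ log (1 - z / s) dμ(s)` in the disc, with the principal branch; its
real part is the logarithmic potential of `μ`. -/
noncomputable def complexPotential (μ : Measure Circle) (z : ℂ) : ℂ :=
  ∫ s : Circle, Complex.log (1 - z * ((s⁻¹ : Circle) : ℂ)) ∂μ

lemma one_sub_mul_mem_slitPlane {z : ℂ} (hz : ‖z‖ < 1) (s : Circle) :
    1 - z * (s : ℂ) ∈ Complex.slitPlane := by
  left
  have h1 := (Complex.re_le_norm (z * (s : ℂ)))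
  rw [norm_mul, Circle.norm_coe, mul_one] at h1
  rw [Complex.sub_re, Complex.one_re]
  linarith

lemma continuous_log_one_sub_mul {z : ℂ} (hz : ‖z‖ < 1) :
    Continuous fun s : Circle => Complex.log (1 - z * ((s⁻¹ : Circle) : ℂ)) :=
  Continuous.clog (by fun_prop) fun s => one_sub_mul_mem_slitPlane hz s⁻¹

lemma integrable_of_continuous {E : Type*} [NormedAddCommGroup E] {μ : Measure Circle}
    [IsProbabilityMeasure μ] [SecondCountableTopology E] {f : Circle → E} (hf : Continuous f) :
    Integrable f μ := by
  obtain ⟨C, hC⟩ := isCompact_univ.exists_bound_of_continuousOn hf.continuousOn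
  exact (integrable_const C).mono' hf.aestronglyMeasurable
    (Eventually.of_forall fun s => hC s (mem_univ s))

lemma hasDerivAt_complexPotential (μ : Measure Circle) [IsProbabilityMeasure μ] {z : ℂ}
    (hz : ‖z‖ < 1) :
    HasDerivAt (complexPotential μ) (∫ s : Circle, -1 / ((s : ℂ) - z) ∂μ) z := by
  set δ := (1 - ‖z‖) / 2 with hδ
  have hδ0 : 0 < δ := by linarith
  have hball : ∀ x ∈ Metric.ball z δ, ‖x‖ ≤ 1 - δ := fun x hx => by
    rw [mem_ball_iff_norm] at hx
    have := norm_le_norm_add_norm_sub' x z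
    linarith
  refine (hasDerivAt_integral_of_dominated_loc_of_deriv_le (Metric.ball_mem_nhds z hδ0)
    (F' := fun x (s : Circle) => -1 / ((s : ℂ) - x)) (bound := fun _ => 1 / δ)
    ?_ (integrable_of_continuous (continuous_log_one_sub_mul hz)) ?_ ?_ (integrable_const _) ?_).2
  · filter_upwards [Metric.ball_mem_nhds z hδ0] with x hx
    exact (continuous_log_one_sub_mul (by linarith [hball x hx])).aestronglyMeasurable
  · refine Continuous.aestronglyMeasurable (Continuous.div (by fun_prop) (by fun_prop) fun s => ?_)
    rw [← norm_pos_iff]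
    linarith [one_sub_norm_le_norm_sub s z]
  · refine Eventually.of_forall fun s x hx => ?_
    rw [norm_div, norm_neg, norm_one]
    exact one_div_le_one_div_of_le hδ0 (by linarith [one_sub_norm_le_norm_sub s x, hball x hx])
  · refine Eventually.of_forall fun s x hx => ?_
    have hx1 : ‖x‖ < 1 := by linarith [hball x hx]
    have h1 : (s : ℂ) - x ≠ 0 := by
      rw [← norm_pos_iff]
      linarith [one_sub_norm_le_norm_sub s x]
    have h2 := (((hasDerivAt_id x).mul_const ((s⁻¹ : Circle) : ℂ)).const_sub 1).clog
      (one_sub_mul_mem_slitPlane hx1 s⁻¹)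
    have hs : (s : ℂ) ≠ 0 := s.coe_ne_zero
    have h3 : (1 : ℂ) - x * (s : ℂ)⁻¹ ≠ 0 := by
      have := Complex.slitPlane_ne_zero (one_sub_mul_mem_slitPlane hx1 s⁻¹)
      simpa using this
    refine HasDerivAt.congr_deriv h2 ?_
    simp only [id, Circle.coe_inv, one_mul]
    symm
    rw [div_eq_div_iff h1 h3]
    field_simp

lemma re_complexPotential (μ : Measure Circle) [IsProbabilityMeasure μ] {z : ℂ} (hz : ‖z‖ < 1) :
    (complexPotential μ z).re = ∫ s : Circle, Real.log ‖1 - z * ((s⁻¹ : Circle) : ℂ)‖ ∂μ := by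
  have h := integral_re (integrable_of_continuous (μ := μ) (continuous_log_one_sub_mul hz))
  simp only [RCLike.re_eq_complex_re, Complex.log_re] at h
  exact h.symm

section Herglotz

variable {μ : Measure Circle} [IsProbabilityMeasure μ] {F : ℂ → ℂ}

/-- The Herglotz transform `F` of `μ` determines the derivative of the complex potential. -/
lemma mul_deriv_complexPotential
    (hF : ∀ z : ℂ, ‖z‖ < 1 → ∫ s : Circle, ((s : ℂ) + z) / (s - z) ∂μ = F z)
    {z : ℂ} (hz : ‖z‖ < 1) : 2 * z * deriv (complexPotential μ) z = 1 - F z := by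
  have hne : ∀ s : Circle, (s : ℂ) - z ≠ 0 := fun s => by
    rw [← norm_pos_iff]
    linarith [one_sub_norm_le_norm_sub s z]
  have hint : Integrable (fun s : Circle => -1 / ((s : ℂ) - z)) μ :=
    integrable_of_continuous (Continuous.div (by fun_prop) (by fun_prop) hne)
  have h1 : ∀ s : Circle, ((s : ℂ) + z) / (s - z) = 1 - 2 * z * (-1 / ((s : ℂ) - z)) := fun s => by
    field_simp [hne s]
    ring
  rw [(hasDerivAt_complexPotential μ hz).deriv, ← hF z hz]
  simp_rw [h1]
  rw [integral_sub (integrable_const _) (hint.const_mul _), integral_const_mul]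
  simp

lemma continuousOn_deriv_complexPotential :
    ContinuousOn (deriv (complexPotential μ)) (Metric.ball 0 1) := by
  have h : DifferentiableOn ℂ (complexPotential μ) (Metric.ball 0 1) := fun z hz =>
    (hasDerivAt_complexPotential μ (by simpa using hz)).differentiableAt.differentiableWithinAt
  exact (h.deriv Metric.isOpen_ball).continuousOn

/-- Change of the potential along a concentric circle. -/
lemma complexPotential_angle
    (hF : ∀ z : ℂ, ‖z‖ < 1 → ∫ s : Circle, ((s : ℂ) + z) / (s - z) ∂μ = F z)
    {r : ℝ} (hr0 : 0 ≤ r) (hr : r < 1) (φ : ℝ) :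
    2 * (complexPotential μ (r * Circle.exp φ)).re - 2 * (complexPotential μ r).re =
      ∫ t in (0 : ℝ)..φ, (F (r * Circle.exp t)).im := by
  have hz : ∀ t : ℝ, ‖(r * Circle.exp t : ℂ)‖ < 1 := fun t => norm_ofReal_mul_circle_lt_one hr0 hr _
  have hderiv : ∀ t : ℝ, HasDerivAt (fun t : ℝ => 2 * (complexPotential μ (r * Circle.exp t)).re)
      (F (r * Circle.exp t)).im t := fun t => by
    have h1 : HasDerivAt (fun t : ℝ => (r * Circle.exp t : ℂ))
        (r * Circle.exp t * Complex.I) t := by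
      have h2 := ((((hasDerivAt_id (t : ℂ)).mul_const Complex.I).cexp).const_mul
        (r : ℂ)).comp_ofReal
      simpa [Circle.coe_exp, mul_assoc] using h2
    have h3 := (hasDerivAt_complexPotential μ (hz t)).comp_of_eq t h1 rfl
    rw [← (hasDerivAt_complexPotential μ (hz t)).deriv] at h3
    have h4 := ((Complex.reCLM.hasFDerivAt.comp_hasDerivAt t h3)).const_mul 2
    refine HasDerivAt.congr_deriv h4 ?_
    have h5 := mul_deriv_complexPotential hF (hz t)
    have h6 : F (r * Circle.exp t) = 1 - 2 * (r * Circle.exp t) *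
      deriv (complexPotential μ) (r * Circle.exp t) := by rw [h5]; ring
    rw [h6]
    generalize deriv (complexPotential μ) (r * Circle.exp t) = k
    generalize (r * Circle.exp t : ℂ) = z
    simp
    ring
  have hcont : Continuous fun t : ℝ => (F (r * Circle.exp t)).im := by
    have h5 : ∀ t : ℝ, F (r * Circle.exp t) = 1 - 2 * (r * Circle.exp t) *
        deriv (complexPotential μ) (r * Circle.exp t) := fun t => by
      rw [mul_deriv_complexPotential hF (hz t)]; ring
    simp_rw [h5]
    have h6 : Continuous fun t : ℝ => deriv (complexPotential μ) (r * Circle.exp t) :=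
      continuousOn_deriv_complexPotential.comp_continuous (by fun_prop) fun t => by
        simpa using hz t
    fun_prop
  rw [intervalIntegral.integral_eq_sub_of_hasDerivAt (fun t _ => hderiv t)
    (hcont.intervalIntegrable _ _)]
  simp

/-- Change of the potential along a radius. -/
lemma complexPotential_radius
    (hF : ∀ z : ℂ, ‖z‖ < 1 → ∫ s : Circle, ((s : ℂ) + z) / (s - z) ∂μ = F z)
    {r : ℝ} (hr0 : 0 ≤ r) (hr : r < 1) :
    IntervalIntegrable (fun s : ℝ => 1 / s * (1 - (F s).re)) volume 0 r ∧
    ∫ s in (0 : ℝ)..r, 1 / s * (1 - (F s).re) = 2 * (complexPotential μ r).re := by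
  have hz : ∀ s ∈ Set.uIcc 0 r, ‖(s : ℂ)‖ < 1 := fun s hs => by
    rw [uIcc_of_le hr0] at hs
    rw [Complex.norm_real, Real.norm_of_nonneg hs.1]
    exact hs.2.trans_lt hr
  have hderiv : ∀ s ∈ Set.uIcc 0 r, HasDerivAt (fun s : ℝ => 2 * (complexPotential μ s).re)
      (2 * (deriv (complexPotential μ) s).re) s := fun s hs => by
    have h3 := (hasDerivAt_complexPotential μ (hz s hs)).comp_ofReal
    rw [← (hasDerivAt_complexPotential μ (hz s hs)).deriv] at h3
    exact (Complex.reCLM.hasFDerivAt.comp_hasDerivAt s h3).const_mul 2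
  have hint : IntervalIntegrable (fun s : ℝ => 2 * (deriv (complexPotential μ) s).re)
      volume 0 r := by
    refine ContinuousOn.intervalIntegrable ?_
    refine continuousOn_const.mul (Complex.continuous_re.comp_continuousOn ?_)
    exact continuousOn_deriv_complexPotential.comp (by fun_prop) fun s hs => by
      simpa using hz s hs
  have heq : ∀ s ∈ Ι 0 r, 2 * (deriv (complexPotential μ) s).re = 1 / s * (1 - (F s).re) := by
    intro s hs
    have h1 := congrArg Complex.re (mul_deriv_complexPotential hF (hz s (uIoc_subset_uIcc hs)))
    rw [uIoc_of_le hr0] at hs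
    have h2 : (2 * (s : ℂ) * deriv (complexPotential μ) s).re =
        2 * s * (deriv (complexPotential μ) s).re := by simp
    rw [h2, Complex.sub_re, Complex.one_re] at h1
    have := hs.1.ne'
    field_simp
    linarith
  refine ⟨hint.congr heq, ?_⟩
  rw [← intervalIntegral.integral_congr_ae (Eventually.of_forall fun s hs => heq s hs),
    intervalIntegral.integral_eq_sub_of_hasDerivAt hderiv hint]
  simp [complexPotential]

/-- If the radial limit of the potential exists, then the kernel is integrable at the boundary
point, and the limit is the logarithmic potential there. -/
lemma integrable_log_and_integral_eq [NullSingletonClass μ] {z : Circle} {L : ℝ}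
    (h : Tendsto (fun r : ℝ => 2 * (complexPotential μ (r * z)).re) (𝓝[<] 1) (𝓝 L)) :
    Integrable (fun s : Circle => Real.log ‖(z : ℂ) - s‖) μ ∧
      2 * ∫ s : Circle, Real.log ‖(z : ℂ) - s‖ ∂μ = L := by
  have hnorm : ∀ s : Circle, ‖(z : ℂ) - s‖ = ‖1 - ((z * s⁻¹ : Circle) : ℂ)‖ := fun s => by
    rw [mul_comm z, norm_one_sub_inv_mul s z, norm_sub_rev]
  have hne : ∀ᵐ s ∂μ, z * s⁻¹ ≠ 1 := by
    filter_upwards [compl_mem_ae_iff.2 (measure_singleton (μ := μ) z)] with s hs h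
    exact hs (mul_inv_eq_one.1 h).symm
  have hG : ∀ᶠ r : ℝ in 𝓝[<] 1, 2 * (complexPotential μ (r * z)).re =
      2 * ∫ s : Circle, Real.log ‖1 - r * ((z * s⁻¹ : Circle) : ℂ)‖ ∂μ := by
    filter_upwards [Ioo_mem_nhdsLT (zero_lt_one' ℝ)] with r hr
    rw [re_complexPotential μ (norm_ofReal_mul_circle_lt_one hr.1.le hr.2 z)]
    simp [mul_assoc]
  have hint : Integrable (fun s : Circle => Real.log ‖1 - ((z * s⁻¹ : Circle) : ℂ)‖) μ := by
    obtain ⟨r, hr⟩ := exists_seq_tendsto (𝓝[<] (1 : ℝ))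
    have hrev := hr.eventually (Ioo_mem_nhdsLT (zero_lt_one' ℝ))
    set f : ℝ → Circle → ℝ := fun r s =>
      Real.log 2 - Real.log ‖1 - r * ((z * s⁻¹ : Circle) : ℂ)‖ with hf
    have hfm : ∀ r, Measurable (f r) := fun r => by
      have : Continuous fun s : Circle => ‖1 - (r : ℂ) * ((z * s⁻¹ : Circle) : ℂ)‖ := by fun_prop
      exact (Real.measurable_log.comp this.measurable).const_sub _
    have hf0 : ∀ r : ℝ, 0 ≤ r → r ≤ 1 → ∀ s, 0 ≤ f r s := fun r hr0 hr1 s => by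
      have h1 : ‖1 - (r : ℂ) * ((z * s⁻¹ : Circle) : ℂ)‖ ≤ 2 := by
        refine (norm_sub_le _ _).trans ?_
        rw [norm_mul, Circle.norm_coe, norm_one, Complex.norm_real, Real.norm_of_nonneg hr0]
        linarith
      rcases (norm_nonneg (1 - (r : ℂ) * ((z * s⁻¹ : Circle) : ℂ))).eq_or_lt with h2 | h2
      · simp only [hf, ← h2, Real.log_zero, sub_zero]
        positivity
      · exact sub_nonneg.2 (Real.log_le_log h2 h1)
    -- Fatou's lemma along a sequence of radii tending to `1`
    have hfatou : ∫⁻ s, ENNReal.ofReal (f 1 s) ∂μ ≤ ENNReal.ofReal (Real.log 2 - L / 2) := by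
      have h1 : ∫⁻ s, ENNReal.ofReal (f 1 s) ∂μ ≤
          ∫⁻ s, liminf (fun n => ENNReal.ofReal (f (r n) s)) atTop ∂μ := by
        refine lintegral_mono_ae (hne.mono fun s hs => le_of_eq (Tendsto.liminf_eq ?_).symm)
        refine ENNReal.tendsto_ofReal ?_
        have h0 : ‖1 - ((1 : ℝ) : ℂ) * ((z * s⁻¹ : Circle) : ℂ)‖ ≠ 0 := by
          rw [Complex.ofReal_one, one_mul, norm_ne_zero_iff, sub_ne_zero]
          exact fun h' => hs (Circle.ext (by simpa using h'.symm))
        have hc : ContinuousAt (fun r : ℝ => f r s) 1 :=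
          continuousAt_const.sub (ContinuousAt.log (by fun_prop) h0)
        exact (hc.tendsto.mono_left nhdsWithin_le_nhds).comp hr
      refine h1.trans ((lintegral_liminf_le fun n => (hfm _).ennreal_ofReal).trans ?_)
      refine le_of_eq (Tendsto.liminf_eq ?_)
      have h2 : Tendsto (fun n => Real.log 2 - 2 * (complexPotential μ (r n * z)).re / 2) atTop
          (𝓝 (Real.log 2 - L / 2)) := ((h.comp hr).div_const 2).const_sub _
      refine (ENNReal.tendsto_ofReal h2).congr' ?_
      filter_upwards [hrev, hr.eventually hG] with n hn hGn
      have hcont : Continuous fun s : Circle =>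
          Real.log ‖1 - (r n : ℂ) * ((z * s⁻¹ : Circle) : ℂ)‖ := by
        refine Continuous.log (by fun_prop) fun s => ?_
        rw [norm_ne_zero_iff]
        have := Complex.slitPlane_ne_zero (one_sub_mul_mem_slitPlane
          (norm_ofReal_mul_circle_lt_one hn.1.le hn.2 1) (z * s⁻¹))
        simpa using this
      have hi := integrable_of_continuous (μ := μ) hcont
      have h3 := ofReal_integral_eq_lintegral_ofReal (f := f (r n)) (μ := μ)
        ((integrable_const _).sub hi) (Eventually.of_forall (hf0 _ hn.1.le hn.2.le))
      have h4 : ∫ s, f (r n) s ∂μ =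
          Real.log 2 - ∫ s : Circle, Real.log ‖1 - (r n : ℂ) * ((z * s⁻¹ : Circle) : ℂ)‖ ∂μ := by
        rw [integral_sub (integrable_const _) hi]
        simp
      rw [← h3, h4, hGn]
      congr 1
      ring
    have hfi : Integrable (f 1) μ := by
      refine ⟨(hfm 1).aestronglyMeasurable, ?_⟩
      rw [hasFiniteIntegral_iff_ofReal (Eventually.of_forall (hf0 1 zero_le_one le_rfl))]
      exact hfatou.trans_lt ENNReal.ofReal_lt_top
    have := (integrable_const (Real.log 2)).sub hfi
    refine this.congr (Eventually.of_forall fun s => ?_)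
    simp [hf]
  simp_rw [hnorm]
  refine ⟨hint, ?_⟩
  have hlim := (tendsto_integral_log_norm_one_sub (ρ := μ) (w := fun s => z * s⁻¹) (by fun_prop)
    hne hint).const_mul 2
  exact tendsto_nhds_unique (hlim.congr' (hG.mono fun r hr => hr.symm)) h

/-- The logarithmic potential on the circle, from the boundary values `v` of the imaginary part of
the Herglotz transform: integration along the radius to `r`, then along the circle of radius `r`,
and `r → 1`. -/
lemma integral_log_norm_exp_sub [NullSingletonClass μ]
    (hF : ∀ z : ℂ, ‖z‖ < 1 → ∫ s : Circle, ((s : ℂ) + z) / (s - z) ∂μ = F z)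
    (hFc : ContinuousOn F (Metric.ball 0 1))
    (hconj : ∀ z : ℂ, ‖z‖ < 1 → (F (conj z)).im = -(F z).im)
    {v B : ℝ → ℝ} (hB : IntervalIntegrable B volume 0 π)
    (hFB : ∀ᵐ t : ℝ, ∀ r : ℝ, 0 ≤ r → r < 1 → |(F (r * Circle.exp t)).im| ≤ B t)
    (hFv : ∀ᵐ t : ℝ, t ∈ Icc 0 π →
      Tendsto (fun r : ℝ => (F (r * Circle.exp t)).im) (𝓝[<] 1) (𝓝 (v t)))
    (hq : IntervalIntegrable (fun s : ℝ => 1 / s * (1 - (F s).re)) volume 0 1)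
    {φ : ℝ} (hφ : |φ| ≤ π) :
    Integrable (fun s : Circle => Real.log ‖(Circle.exp φ : ℂ) - s‖) μ ∧
      2 * ∫ s : Circle, Real.log ‖(Circle.exp φ : ℂ) - s‖ ∂μ =
        (∫ s in (0 : ℝ)..1, 1 / s * (1 - (F s).re)) + ∫ t in (0 : ℝ)..|φ|, v t := by
  refine integrable_log_and_integral_eq ?_
  have h1 : Tendsto (fun r : ℝ => ∫ s in (0 : ℝ)..r, 1 / s * (1 - (F s).re)) (𝓝[<] 1)
      (𝓝 (∫ s in (0 : ℝ)..1, 1 / s * (1 - (F s).re))) := by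
    have hc := intervalIntegral.continuousOn_primitive_interval
      ((intervalIntegrable_iff').1 hq)
    have := hc 1 right_mem_uIcc
    refine this.mono_left (nhdsWithin_le_iff.2 ?_)
    filter_upwards [Ioo_mem_nhdsLT (zero_lt_one' ℝ)] with r hr
    rw [uIcc_of_le zero_le_one]
    exact ⟨hr.1.le, hr.2.le⟩
  have hFm : ∀ r : ℝ, 0 ≤ r → r < 1 → Continuous fun t : ℝ => (F (r * Circle.exp t)).im := by
    intro r hr0 hr
    exact Complex.continuous_im.comp (hFc.comp_continuous (by fun_prop) fun t => by
      simpa using norm_ofReal_mul_circle_lt_one hr0 hr (Circle.exp t))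
  have h2 : Tendsto (fun r : ℝ => ∫ t in (0 : ℝ)..|φ|, (F (r * Circle.exp t)).im) (𝓝[<] 1)
      (𝓝 (∫ t in (0 : ℝ)..|φ|, v t)) := by
    have hsub : Ι 0 |φ| ⊆ Icc 0 π := by
      rw [uIoc_of_le (abs_nonneg φ)]
      exact fun t ht => ⟨ht.1.le, ht.2.trans hφ⟩
    refine intervalIntegral.tendsto_integral_filter_of_dominated_convergence B ?_ ?_ ?_ ?_
    · filter_upwards [Ioo_mem_nhdsLT (zero_lt_one' ℝ)] with r hr
      exact (hFm r hr.1.le hr.2).aestronglyMeasurable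
    · filter_upwards [Ioo_mem_nhdsLT (zero_lt_one' ℝ)] with r hr
      filter_upwards [hFB] with t ht _ using ht r hr.1.le hr.2
    · refine hB.mono_set ?_
      rw [uIcc_of_le (abs_nonneg φ), uIcc_of_le pi_nonneg]
      exact Icc_subset_Icc_right hφ
    · filter_upwards [hFv] with t ht htm using ht (hsub htm)
  refine (h1.add h2).congr' ?_
  filter_upwards [Ioo_mem_nhdsLT (zero_lt_one' ℝ)] with r hr
  -- the imaginary part is odd in the angle, so that the angle may be replaced by its absolute value
  have hodd : ∫ t in (0 : ℝ)..|φ|, (F (r * Circle.exp t)).im =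
      ∫ t in (0 : ℝ)..φ, (F (r * Circle.exp t)).im := by
    rcases le_total 0 φ with h0 | h0
    · rw [abs_of_nonneg h0]
    · have h3 : ∀ t : ℝ, (F (r * Circle.exp (-t))).im = -(F (r * Circle.exp t)).im := fun t => by
        rw [← hconj _ (norm_ofReal_mul_circle_lt_one hr.1.le hr.2 _), map_mul, Complex.conj_ofReal,
          Circle.exp_neg, Circle.coe_inv_eq_conj]
      rw [abs_of_nonpos h0]
      have h4 := intervalIntegral.integral_comp_neg (a := 0) (b := φ)
        (fun t : ℝ => (F (r * Circle.exp t)).im)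
      simp_rw [h3] at h4
      rw [intervalIntegral.integral_neg, neg_zero] at h4
      rw [intervalIntegral.integral_symm]
      linarith
  rw [hodd, ← complexPotential_angle hF hr.1.le hr.2 φ, (complexPotential_radius hF hr.1.le hr.2).2]
  ring

end Herglotz

/-! ### Integrability of the boundary values -/

/-- Half-angle lower bound for `|cos θ - cos θ₀|`, linear in `|θ - θ₀|`. -/
lemma exists_mul_abs_sub_le_abs_cos_sub {θ₀ : ℝ} (h0 : 0 < θ₀) (hπ : θ₀ < π) :
    ∃ m > 0, ∀ θ ∈ Icc 0 π, m * |θ - θ₀| ≤ |Real.cos θ - Real.cos θ₀| := by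
  have hs : 0 < min (Real.sin (θ₀ / 2)) (Real.sin ((π + θ₀) / 2)) :=
    lt_min (Real.sin_pos_of_pos_of_lt_pi (by linarith) (by linarith))
      (Real.sin_pos_of_pos_of_lt_pi (by linarith) (by linarith))
  refine ⟨2 * min (Real.sin (θ₀ / 2)) (Real.sin ((π + θ₀) / 2)) / π, by positivity, fun θ hθ => ?_⟩
  have h1 : min (Real.sin (θ₀ / 2)) (Real.sin ((π + θ₀) / 2)) ≤ Real.sin ((θ + θ₀) / 2) :=
    strictConcaveOn_sin_Icc.concaveOn.min_le_of_mem_Icc (x := θ₀ / 2) (y := (π + θ₀) / 2)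
      ⟨by linarith, by linarith⟩ ⟨by linarith, by linarith⟩ ⟨by linarith [hθ.1], by linarith [hθ.2]⟩
  have h2 : 2 / π * |(θ - θ₀) / 2| ≤ |Real.sin ((θ - θ₀) / 2)| :=
    Real.mul_abs_le_abs_sin (by rw [abs_le]; constructor <;> linarith [hθ.1, hθ.2])
  rw [Real.cos_sub_cos, abs_mul, abs_mul, abs_neg, abs_two]
  have h3 : min (Real.sin (θ₀ / 2)) (Real.sin ((π + θ₀) / 2)) ≤ |Real.sin ((θ + θ₀) / 2)| :=
    h1.trans (le_abs_self _)
  have h4 := mul_le_mul h3 h2 (by positivity) (abs_nonneg _)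
  have h5 : 2 / π * |(θ - θ₀) / 2| = |θ - θ₀| / π := by
    rw [abs_div, abs_two]
    field_simp
  rw [h5] at h4
  calc _ = 2 * (min (Real.sin (θ₀ / 2)) (Real.sin ((π + θ₀) / 2)) * (|θ - θ₀| / π)) := by ring
    _ ≤ 2 * (|Real.sin ((θ + θ₀) / 2)| * |Real.sin ((θ - θ₀) / 2)|) := by linarith
    _ = _ := by ring

/-- The function `√(8 / |cos θ - c|)`, which dominates `discRoot` on each ray of argument `θ`; its
singularities are integrable, of inverse square root type. -/
noncomputable def singularBound (c θ : ℝ) : ℝ := √(8 / |Real.cos θ - c|)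

lemma intervalIntegrable_singularBound {θ₀ : ℝ} (h0 : 0 < θ₀) (hπ : θ₀ < π) :
    IntervalIntegrable (singularBound (Real.cos θ₀)) volume 0 π := by
  obtain ⟨m, hm, hle⟩ := exists_mul_abs_sub_le_abs_cos_sub h0 hπ
  have hpow : IntervalIntegrable (fun x : ℝ => √(8 / m) * x ^ (-1 / 2 : ℝ)) volume 0 π :=
    (intervalIntegral.intervalIntegrable_rpow' (by norm_num)).const_mul _
  have hmeas : ∀ s : Set ℝ, AEStronglyMeasurable (singularBound (Real.cos θ₀))
      (volume.restrict s) := fun s => by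
    unfold singularBound
    exact Measurable.aestronglyMeasurable (by fun_prop)
  have hbound : ∀ θ ∈ Icc 0 π, θ ≠ θ₀ →
      ‖singularBound (Real.cos θ₀) θ‖ ≤ ‖√(8 / m) * |θ - θ₀| ^ (-1 / 2 : ℝ)‖ := by
    intro θ hθ hne
    have h1 : 0 < |θ - θ₀| := abs_pos.2 (sub_ne_zero.2 hne)
    rw [singularBound, Real.norm_of_nonneg (Real.sqrt_nonneg _),
      Real.norm_of_nonneg (by positivity), neg_div, Real.rpow_neg h1.le, ← Real.sqrt_eq_rpow,
      ← Real.sqrt_inv, ← Real.sqrt_mul (by positivity)]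
    refine Real.sqrt_le_sqrt ?_
    calc 8 / |Real.cos θ - Real.cos θ₀| ≤ 8 / (m * |θ - θ₀|) :=
          div_le_div_of_nonneg_left (by norm_num) (by positivity) (hle θ hθ)
      _ = 8 / m * |θ - θ₀|⁻¹ := by field_simp
  have hne : ∀ᵐ θ : ℝ, θ ≠ θ₀ := by
    simp [ae_iff]
  have hleft : IntervalIntegrable (singularBound (Real.cos θ₀)) volume 0 θ₀ := by
    have h1 : IntervalIntegrable (fun x : ℝ => √(8 / m) * (θ₀ - x) ^ (-1 / 2 : ℝ)) volume 0 θ₀ := by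
      have := (intervalIntegral.intervalIntegrable_rpow' (a := 0) (b := θ₀) (r := -1 / 2)
        (by norm_num)).comp_sub_left θ₀
      rw [sub_zero, sub_self] at this
      exact (this.symm).const_mul _
    refine h1.mono_fun (hmeas _) ?_
    rw [uIoc_of_le h0.le]
    filter_upwards [ae_restrict_mem measurableSet_Ioc, ae_restrict_of_ae hne] with θ hθ hθne
    have := hbound θ ⟨hθ.1.le, by linarith [hθ.2]⟩ hθne
    rwa [abs_sub_comm, abs_of_nonneg (by linarith [hθ.2])] at this
  have hright : IntervalIntegrable (singularBound (Real.cos θ₀)) volume θ₀ π := by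
    have h1 : IntervalIntegrable (fun x : ℝ => √(8 / m) * (x - θ₀) ^ (-1 / 2 : ℝ)) volume θ₀ π := by
      have := (intervalIntegral.intervalIntegrable_rpow' (a := 0) (b := π - θ₀) (r := -1 / 2)
        (by norm_num)).comp_sub_right θ₀
      rw [zero_add, sub_add_cancel] at this
      exact this.const_mul _
    refine h1.mono_fun (hmeas _) ?_
    rw [uIoc_of_le hπ.le]
    filter_upwards [ae_restrict_mem measurableSet_Ioc, ae_restrict_of_ae hne] with θ hθ hθne
    have := hbound θ ⟨by linarith [hθ.1], hθ.2⟩ hθne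
    rwa [abs_of_nonneg (by linarith [hθ.1])] at this
  exact hleft.trans hright

lemma intervalIntegrable_singularBound_neg {θ₀ : ℝ} (h0 : 0 < θ₀) (hπ : θ₀ < π) :
    IntervalIntegrable (singularBound (Real.cos θ₀)) volume (-π) π := by
  have h := intervalIntegrable_singularBound h0 hπ
  have h1 : IntervalIntegrable (fun θ => singularBound (Real.cos θ₀) (0 - θ)) volume
      (0 - 0) (0 - π) :=
    h.comp_sub_left 0
  simp only [zero_sub, neg_zero, singularBound, Real.cos_neg] at h1
  exact h1.symm.trans h

lemma ae_cos_ne (θ₀ : ℝ) : ∀ᵐ θ : ℝ, Real.cos θ ≠ Real.cos θ₀ := by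
  have h : {θ : ℝ | Real.cos θ = Real.cos θ₀} ⊆
      (Set.range fun k : ℤ => 2 * k * π + θ₀) ∪ Set.range fun k : ℤ => 2 * k * π - θ₀ := by
    intro θ hθ
    obtain ⟨k, hk | hk⟩ := Real.cos_eq_cos_iff.1 (Eq.symm hθ)
    · exact Or.inl ⟨k, hk.symm⟩
    · exact Or.inr ⟨k, hk.symm⟩
  have h2 := ((Set.countable_range _).union (Set.countable_range _)).mono h
  exact compl_mem_ae_iff.2 (h2.measure_zero volume)

lemma sqrt_norm_discRatio_le {a c : ℝ} (ha : -1 ≤ a) (ha' : a ≤ 1) (hc : -1 ≤ c) (hc' : c ≤ 1)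
    {r : ℝ} (hr0 : 0 ≤ r) (hr : r ≤ 1) {θ : ℝ} (hθ : Real.cos θ ≠ c) :
    √‖discRatio a c (r * Circle.exp θ)‖ ≤ singularBound c θ :=
  Real.sqrt_le_sqrt (norm_discRatio_le ha ha' hc hc' hr0 hr hθ)

/-- The admissible endpoints: the gap between the two arcs is nonempty. The value `θ₁ = 0`, for
which the second arc degenerates to a point, is allowed. -/
structure Admissible (θ₀ θ₁ : ℝ) : Prop where
  pos : 0 < θ₀
  lt_pi : θ₀ < π
  nonneg : 0 ≤ θ₁
  add_lt : θ₀ + θ₁ < π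

namespace Admissible

variable {θ₀ θ₁ : ℝ} (h : Admissible θ₀ θ₁)
include h

lemma cos_add_cos_pos : 0 < Real.cos θ₁ + Real.cos θ₀ := by
  have h1 := Real.strictAntiOn_cos ⟨h.nonneg, by linarith [h.pos, h.add_lt]⟩
    ⟨by linarith [h.lt_pi], by linarith [h.pos]⟩ (by linarith [h.add_lt] : θ₁ < π - θ₀)
  rw [Real.cos_pi_sub] at h1
  linarith

lemma cos_lt_one : Real.cos θ₀ < 1 := by
  have := Real.strictAntiOn_cos ⟨le_rfl, pi_nonneg⟩ ⟨h.pos.le, h.lt_pi.le⟩ h.pos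
  simpa using this

/-- The Herglotz transform of the boundary density is the holomorphic square root. Since this is not
continuous up to the boundary, the Herglotz formula is applied to the dilations `w ↦ F (r w)`. -/
lemma herglotz {z : ℂ} (hz : ‖z‖ < 1) :
    ∫ θ in (-π)..π, ((Circle.exp θ : ℂ) + z) / (Circle.exp θ - z) *
      ((twoArcDensity θ₀ θ₁ θ : ℝ) : ℂ) = discRoot (Real.cos θ₁) (Real.cos θ₀) z := by
  set a := Real.cos θ₁
  set c := Real.cos θ₀ with hcdef
  have ha := Real.neg_one_le_cos θ₁
  have ha' := Real.cos_le_one θ₁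
  have hc := Real.neg_one_le_cos θ₀
  have hc' : c < 1 := h.cos_lt_one
  have hac : 0 < a + c := h.cos_add_cos_pos
  have hden : ∀ θ : ℝ, (Circle.exp θ : ℂ) - z ≠ 0 := fun θ => by
    rw [← norm_pos_iff]
    linarith [one_sub_norm_le_norm_sub (Circle.exp θ) z]
  have hkc : Continuous fun θ : ℝ => ((Circle.exp θ : ℂ) + z) / (Circle.exp θ - z) :=
    Continuous.div (by fun_prop) (by fun_prop) hden
  have hk : ∀ θ : ℝ, ‖((Circle.exp θ : ℂ) + z) / (Circle.exp θ - z)‖ ≤ 2 / (1 - ‖z‖) := fun θ => by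
    rw [norm_div]
    refine div_le_div₀ (by norm_num) ?_ (by linarith) (one_sub_norm_le_norm_sub _ z)
    refine (norm_add_le _ _).trans ?_
    rw [Circle.norm_coe]
    linarith
  have hrz : ∀ r : ℝ, r ∈ Ioo (0 : ℝ) 1 → ∀ w : ℂ, ‖w‖ ≤ 1 → ‖(r : ℂ) * w‖ < 1 := by
    intro r hr w hw
    rw [norm_mul, Complex.norm_real, Real.norm_of_nonneg hr.1.le]
    nlinarith [hr.1, hr.2, norm_nonneg w]
  -- the formula on smaller circles
  have h1 : ∀ r : ℝ, r ∈ Ioo (0 : ℝ) 1 →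
      (2 * π)⁻¹ • ∫ θ in (-π)..π, ((Circle.exp θ : ℂ) + z) / (Circle.exp θ - z) *
        (((discRoot a c (r * Circle.exp θ)).re : ℝ) : ℂ) = discRoot a c (r * z) := by
    intro r hr
    have hd : DiffContOnCl ℂ (fun w => discRoot a c (r * w)) (Metric.ball 0 1) := by
      refine DifferentiableOn.diffContOnCl ?_
      rw [closure_ball _ one_ne_zero]
      intro w hw
      have hw' : ‖(r : ℂ) * w‖ < 1 := hrz r hr w (by simpa using hw)
      exact ((differentiableAt_discRoot ha' hc' hac hw').comp w
        (by fun_prop)).differentiableWithinAt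
    have h2 := circleAverage_herglotz_mul_re hd hz (by simp [discRoot_zero])
    rw [← h2, circleAverage_def]
    have hcm : ∀ θ : ℝ, circleMap 0 1 θ = Circle.exp θ := fun θ => by
      simp [circleMap, Circle.coe_exp]
    simp_rw [← hcm]
    have hper : Function.Periodic (fun θ : ℝ => (circleMap 0 1 θ + z) / (circleMap 0 1 θ - z) *
        (((discRoot a c (r * circleMap 0 1 θ)).re : ℝ) : ℂ)) (2 * π) := fun θ => by
      simp only [periodic_circleMap 0 1 θ]
    have h3 := hper.intervalIntegral_add_eq (-π) 0
    rw [zero_add, show -π + 2 * π = π by ring] at h3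
    rw [h3]
  have hlim1 : Tendsto (fun r : ℝ => discRoot a c (r * z)) (𝓝[<] 1) (𝓝 (discRoot a c z)) := by
    have hct : ContinuousAt (fun r : ℝ => discRoot a c (r * z)) 1 := by
      have h0 : Continuous fun r : ℝ => (r : ℂ) * z := by fun_prop
      exact ContinuousAt.comp_of_eq (g := discRoot a c) (f := fun r : ℝ => (r : ℂ) * z)
        (differentiableAt_discRoot ha' hc' hac hz).continuousAt h0.continuousAt (by simp)
    simpa using hct.tendsto.mono_left (nhdsWithin_le_nhds (s := Iio 1))
  have hlim2 : Tendsto (fun r : ℝ => (2 * π)⁻¹ •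
      ∫ θ in (-π)..π, ((Circle.exp θ : ℂ) + z) / (Circle.exp θ - z) *
        (((discRoot a c (r * Circle.exp θ)).re : ℝ) : ℂ)) (𝓝[<] 1)
      (𝓝 ((2 * π)⁻¹ • ∫ θ in (-π)..π, ((Circle.exp θ : ℂ) + z) / (Circle.exp θ - z) *
        ((√(circleRatio a c θ) : ℝ) : ℂ))) := by
    refine Tendsto.const_smul ?_ _
    refine intervalIntegral.tendsto_integral_filter_of_dominated_convergence
      (fun θ => 2 / (1 - ‖z‖) * singularBound c θ) ?_ ?_
      ((intervalIntegrable_singularBound_neg h.pos h.lt_pi).const_mul _) ?_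
    · filter_upwards [Ioo_mem_nhdsLT (zero_lt_one' ℝ)] with r hr
      refine Continuous.aestronglyMeasurable (hkc.mul (Complex.continuous_ofReal.comp
        (Complex.continuous_re.comp ?_)))
      refine continuous_iff_continuousAt.2 fun θ => ?_
      exact ContinuousAt.comp (f := fun θ : ℝ => (r : ℂ) * Circle.exp θ)
        (differentiableAt_discRoot ha' hc' hac
          (norm_ofReal_mul_circle_lt_one hr.1.le hr.2 _)).continuousAt (by fun_prop)
    · filter_upwards [Ioo_mem_nhdsLT (zero_lt_one' ℝ)] with r hr
      filter_upwards [ae_cos_ne θ₀] with θ hθ _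
      rw [norm_mul, Complex.norm_real, Real.norm_eq_abs]
      exact mul_le_mul (hk θ) ((abs_re_discRoot_le a c _).trans
        (sqrt_norm_discRatio_le ha ha' hc hc'.le hr.1.le hr.2.le hθ)) (abs_nonneg _)
        (div_nonneg (by norm_num) (by linarith))
    · filter_upwards [ae_cos_ne θ₀] with θ hθ _
      exact ((Complex.continuous_ofReal.tendsto _).comp (tendsto_re_discRoot hθ)).const_mul _
  have h4 := tendsto_nhds_unique (hlim1.congr' (by
    filter_upwards [Ioo_mem_nhdsLT (zero_lt_one' ℝ)] with r hr using (h1 r hr).symm)) hlim2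
  rw [h4, ← intervalIntegral.integral_smul]
  refine intervalIntegral.integral_congr fun θ _ => ?_
  simp only [twoArcDensity, circleRatio, a, c, Complex.real_smul]
  push_cast
  ring

end Admissible

/-! ### The measure with the given density -/

lemma measurable_twoArcDensity (θ₀ θ₁ : ℝ) : Measurable (twoArcDensity θ₀ θ₁) := by
  unfold twoArcDensity
  fun_prop

lemma twoArcDensity_nonneg (θ₀ θ₁ θ : ℝ) : 0 ≤ twoArcDensity θ₀ θ₁ θ := by
  unfold twoArcDensity
  positivity

/-- The integrand of `ℓ` is the integrand for the potential along the radius to `1`. -/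
lemma ellIntegrand_eq (θ₀ θ₁ s : ℝ) : ellIntegrand θ₀ θ₁ s =
    1 / s * (1 - (discRoot (Real.cos θ₁) (Real.cos θ₀) s).re) := by
  have hR : discRatio (Real.cos θ₁) (Real.cos θ₀) s =
      (((s ^ 2 + 2 * Real.cos θ₁ * s + 1) / (s ^ 2 - 2 * Real.cos θ₀ * s + 1) : ℝ) : ℂ) := by
    rw [discRatio]
    push_cast
    rfl
  rw [ellIntegrand, re_discRoot, hR, Complex.norm_real, Real.norm_eq_abs, Complex.ofReal_re,
    sqrt_half_abs_add]

/-- The measure on the circle with density `twoArcDensity`. -/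
noncomputable abbrev twoArcMeasure (θ₀ θ₁ : ℝ) : Measure Circle :=
  angularMeasure (twoArcAngles θ₀ θ₁) (twoArcDensity θ₀ θ₁)

lemma measurable_circleExp : Measurable Circle.exp := Circle.exp.continuous.measurable

lemma integral_twoArcMeasure {E : Type*} [NormedAddCommGroup E] [NormedSpace ℝ E] (θ₀ θ₁ : ℝ)
    {f : Circle → E} (hf : StronglyMeasurable f) :
    ∫ s, f s ∂twoArcMeasure θ₀ θ₁ =
      ∫ θ in twoArcAngles θ₀ θ₁, twoArcDensity θ₀ θ₁ θ • f (Circle.exp θ) := by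
  rw [twoArcMeasure, angularMeasure, integral_map measurable_circleExp.aemeasurable
    hf.aestronglyMeasurable, integral_withDensity_eq_integral_toReal_smul
    (measurable_twoArcDensity θ₀ θ₁).ennreal_ofReal (Eventually.of_forall fun _ =>
      ENNReal.ofReal_lt_top)]
  simp_rw [ENNReal.toReal_ofReal (twoArcDensity_nonneg θ₀ θ₁ _)]

lemma countable_preimage_circleExp (z : Circle) : (Circle.exp ⁻¹' {z}).Countable := by
  refine (Set.countable_range fun k : ℤ => z.1.arg + k * (2 * π)).mono fun θ hθ => ?_
  have h1 : Circle.exp z.1.arg = Circle.exp θ := by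
    rw [hθ, Circle.exp_arg]
  obtain ⟨k, hk⟩ := Circle.exp_eq_exp.1 h1
  exact ⟨-k, by push_cast; linarith⟩

instance (A : Set ℝ) (v : ℝ → ℝ) : NullSingletonClass (angularMeasure A v) where
  measure_singleton z := by
    rw [angularMeasure, Measure.map_apply measurable_circleExp (measurableSet_singleton z)]
    refine withDensity_absolutelyContinuous _ _ ?_
    exact Measure.absolutelyContinuous_of_le Measure.restrict_le_self
      ((countable_preimage_circleExp z).measure_zero volume)

namespace Admissible

variable {θ₀ θ₁ : ℝ} (h : Admissible θ₀ θ₁)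
include h

lemma circleRatio_nonpos {θ : ℝ} (h1 : θ₀ ≤ θ) (h2 : θ ≤ π - θ₁) :
    circleRatio (Real.cos θ₁) (Real.cos θ₀) θ ≤ 0 := by
  have h3 := Real.strictAntiOn_cos.antitoneOn ⟨h.pos.le, h.lt_pi.le⟩
    ⟨by linarith [h.pos], by linarith [h.nonneg]⟩ h1
  have h4 := Real.strictAntiOn_cos.antitoneOn ⟨by linarith [h.pos], by linarith [h.nonneg]⟩
    ⟨by linarith [h.add_lt, h.pos], by linarith [h.nonneg]⟩ h2
  rw [Real.cos_pi_sub] at h4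
  exact div_nonpos_of_nonneg_of_nonpos (by linarith) (by linarith)

/-- Off the two arcs the formula for the density gives `0`, because `√` of a negative number is `0`.
The angles run over one period, starting at the left endpoint of `γ`. -/
lemma twoArcDensity_eq_zero {θ : ℝ} (h1 : θ ∈ Ioc (-θ₀) (2 * π - θ₀))
    (h2 : θ ∉ twoArcAngles θ₀ θ₁) : twoArcDensity θ₀ θ₁ θ = 0 := by
  have key : circleRatio (Real.cos θ₁) (Real.cos θ₀) θ ≤ 0 := by
    simp only [twoArcAngles, mem_union, mem_Icc, not_or, not_and, not_le] at h2
    have h3 := h2.1 h1.1.le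
    rcases lt_or_ge θ (π - θ₁) with h4 | h4
    · exact h.circleRatio_nonpos h3.le h4.le
    · have h5 := h2.2 h4
      have h6 := h.circleRatio_nonpos (θ := 2 * π - θ) (by linarith [h1.2]) (by linarith)
      rwa [circleRatio, Real.cos_two_pi_sub] at h6
  rw [twoArcDensity, ← circleRatio, Real.sqrt_eq_zero_of_nonpos key, mul_zero]

lemma setIntegral_twoArcAngles {E : Type*} [NormedAddCommGroup E] [NormedSpace ℝ E]
    (f : Circle → E) :
    ∫ θ in twoArcAngles θ₀ θ₁, twoArcDensity θ₀ θ₁ θ • f (Circle.exp θ) =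
      ∫ θ in (-π)..π, twoArcDensity θ₀ θ₁ θ • f (Circle.exp θ) := by
  have hper : Function.Periodic (fun θ => twoArcDensity θ₀ θ₁ θ • f (Circle.exp θ)) (2 * π) := by
    intro θ
    simp only [twoArcDensity, Real.cos_add_two_pi, Circle.periodic_exp θ]
  have h1 := hper.intervalIntegral_add_eq (-π) (-θ₀)
  rw [show -π + 2 * π = π by ring] at h1
  rw [h1, intervalIntegral.integral_of_le (by linarith [pi_pos]), ← integral_Icc_eq_integral_Ioc]
  symm
  refine setIntegral_eq_of_subset_of_ae_sdiff_eq_zero measurableSet_Icc.nullMeasurableSet ?_ ?_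
  · rintro θ (hθ | hθ)
    · exact ⟨hθ.1, by linarith [hθ.2, h.lt_pi]⟩
    · exact ⟨by linarith [hθ.1, h.pos, h.add_lt], by linarith [hθ.2, h.add_lt]⟩
  · refine Eventually.of_forall fun θ hθ => ?_
    have h2 : θ ≠ -θ₀ := fun h3 => hθ.2 (Or.inl ⟨h3.ge, by linarith [h.pos]⟩)
    have h3 : θ ∈ Ioc (-θ₀) (2 * π - θ₀) :=
      ⟨lt_of_le_of_ne hθ.1.1 (Ne.symm h2), by linarith [hθ.1.2]⟩
    rw [h.twoArcDensity_eq_zero h3 hθ.2, zero_smul]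

/-- The density has total mass `1`: its mass is the value of the Herglotz transform at `0`. -/
lemma isProbabilityMeasure : IsProbabilityMeasure (twoArcMeasure θ₀ θ₁) := by
  have h1 := h.herglotz (z := 0) (by simp)
  simp only [add_zero, sub_zero, div_self (Circle.coe_ne_zero _), one_mul, discRoot_zero,
    intervalIntegral.integral_ofReal] at h1
  have h2 : ∫ θ in (-π)..π, twoArcDensity θ₀ θ₁ θ = 1 := by exact_mod_cast h1
  have h3 := h.setIntegral_twoArcAngles (fun _ => (1 : ℝ))
  simp only [smul_eq_mul, mul_one] at h3
  rw [h2] at h3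
  have hint : IntegrableOn (twoArcDensity θ₀ θ₁) (twoArcAngles θ₀ θ₁) := by
    -- a non-integrable density would have the junk integral `0` instead of `1`
    by_contra hcon
    rw [integral_undef hcon] at h3
    norm_num at h3
  refine ⟨?_⟩
  rw [twoArcMeasure, angularMeasure, Measure.map_apply measurable_circleExp MeasurableSet.univ,
    preimage_univ, withDensity_apply _ MeasurableSet.univ, Measure.restrict_univ,
    ← ofReal_integral_eq_lintegral_ofReal hint (Eventually.of_forall (twoArcDensity_nonneg θ₀ θ₁)),
    h3, ENNReal.ofReal_one]

lemma integral_herglotz_twoArcMeasure {z : ℂ} (hz : ‖z‖ < 1) :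
    ∫ s : Circle, ((s : ℂ) + z) / (s - z) ∂twoArcMeasure θ₀ θ₁ =
      discRoot (Real.cos θ₁) (Real.cos θ₀) z := by
  have hcont : Continuous fun s : Circle => ((s : ℂ) + z) / (s - z) := by
    refine Continuous.div (by fun_prop) (by fun_prop) fun s => ?_
    rw [← norm_pos_iff]
    linarith [one_sub_norm_le_norm_sub s z]
  rw [integral_twoArcMeasure θ₀ θ₁ hcont.stronglyMeasurable, h.setIntegral_twoArcAngles
    (fun s : Circle => ((s : ℂ) + z) / (s - z)), ← h.herglotz hz]
  refine intervalIntegral.integral_congr fun θ _ => ?_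
  simp only [Complex.real_smul]
  ring

/-- Near `0` the integrand is twice the real part of the derivative of the complex potential; away
from `0` it is continuous. -/
lemma intervalIntegrable_ellIntegrand :
    IntervalIntegrable (ellIntegrand θ₀ θ₁) volume 0 1 := by
  have := h.isProbabilityMeasure
  have h1 := (complexPotential_radius (μ := twoArcMeasure θ₀ θ₁)
    (fun z hz => h.integral_herglotz_twoArcMeasure hz) (r := 1 / 2) (by norm_num) (by norm_num)).1
  have h2 : IntervalIntegrable (ellIntegrand θ₀ θ₁) volume (1 / 2) 1 := by
    refine ContinuousOn.intervalIntegrable ?_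
    rw [uIcc_of_le (by norm_num)]
    have hden : ∀ s ∈ Icc (1 / 2 : ℝ) 1, s ^ 2 - 2 * Real.cos θ₀ * s + 1 ≠ 0 := fun s hs => by
      have h3 := h.cos_lt_one
      nlinarith [hs.1, hs.2, sq_nonneg (s - 1), mul_pos (sub_pos.2 h3) (by linarith [hs.1] : 0 < s)]
    unfold ellIntegrand
    refine ContinuousOn.mul (ContinuousOn.div (by fun_prop) (by fun_prop) fun s hs => ?_) ?_
    · linarith [hs.1]
    · exact continuousOn_const.sub (ContinuousOn.sqrt (ContinuousOn.div (by fun_prop)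
        (by fun_prop) hden))
  refine IntervalIntegrable.trans (h1.congr fun s _ => ?_) h2
  exact (ellIntegrand_eq θ₀ θ₁ s).symm

/-- The logarithmic potential of the measure, at the point `e^{iφ}` of the circle. -/
lemma integral_log_twoArcMeasure {φ : ℝ} (hφ : |φ| ≤ π) :
    Integrable (fun s : Circle => Real.log ‖(Circle.exp φ : ℂ) - s‖) (twoArcMeasure θ₀ θ₁) ∧
      2 * ∫ s : Circle, Real.log ‖(Circle.exp φ : ℂ) - s‖ ∂twoArcMeasure θ₀ θ₁ =
        (∫ s in (0 : ℝ)..1, ellIntegrand θ₀ θ₁ s) +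
          ∫ t in (0 : ℝ)..|φ|, √(-circleRatio (Real.cos θ₁) (Real.cos θ₀) t) := by
  have := h.isProbabilityMeasure
  have ha := Real.neg_one_le_cos θ₁
  have ha' := Real.cos_le_one θ₁
  have hc := Real.neg_one_le_cos θ₀
  have hc' := h.cos_lt_one
  have hac := h.cos_add_cos_pos
  have hint := h.intervalIntegrable_ellIntegrand
  simp_rw [funext (ellIntegrand_eq θ₀ θ₁)] at hint ⊢
  refine integral_log_norm_exp_sub (fun z hz => h.integral_herglotz_twoArcMeasure hz) ?_
    (fun z hz => im_discRoot_conj ha' hc' hac hz) (intervalIntegrable_singularBound h.pos h.lt_pi)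
    ?_ ?_ hint hφ
  · intro z hz
    exact (differentiableAt_discRoot ha' hc' hac
      (by simpa using hz)).continuousAt.continuousWithinAt
  · filter_upwards [ae_cos_ne θ₀] with t ht r hr0 hr
    exact (abs_im_discRoot_le _ _ _).trans
      (sqrt_norm_discRatio_le ha ha' hc hc'.le hr0 hr.le ht)
  · filter_upwards [ae_cos_ne θ₀] with t ht htm
    exact tendsto_im_discRoot hc hc'.le hac.le ht htm.1 htm.2

end Admissible

/-! ### The increment of the potential across the gap -/

/-- The angular derivative of twice the logarithmic potential on the upper half circle. It vanishes
on the arcs, because `√` of a negative number is `0`. -/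
noncomputable def gapDensity (θ₀ θ₁ t : ℝ) : ℝ :=
  √(-circleRatio (Real.cos θ₁) (Real.cos θ₀) t)

/-- The increment of twice the logarithmic potential from `1` to `-1`. -/
noncomputable def gapIntegral (θ₀ θ₁ : ℝ) : ℝ := ∫ t in (0 : ℝ)..π, gapDensity θ₀ θ₁ t

lemma gapDensity_nonneg (θ₀ θ₁ t : ℝ) : 0 ≤ gapDensity θ₀ θ₁ t := Real.sqrt_nonneg _

lemma measurable_gapDensity (θ₀ θ₁ : ℝ) : Measurable (gapDensity θ₀ θ₁) := by
  unfold gapDensity circleRatio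
  fun_prop

lemma gapDensity_le_singularBound (θ₀ θ₁ t : ℝ) :
    gapDensity θ₀ θ₁ t ≤ singularBound (Real.cos θ₀) t := by
  refine Real.sqrt_le_sqrt ((neg_le_abs _).trans ?_)
  rw [circleRatio, abs_div]
  refine div_le_div_of_nonneg_right ?_ (abs_nonneg _)
  rw [abs_le]
  constructor <;> linarith [Real.neg_one_le_cos t, Real.neg_one_le_cos θ₁, Real.cos_le_one t,
    Real.cos_le_one θ₁]

lemma intervalIntegrable_gapDensity {θ₀ : ℝ} (h0 : 0 < θ₀) (hπ : θ₀ < π) (θ₁ : ℝ) {a b : ℝ}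
    (ha : a ∈ Icc 0 π) (hb : b ∈ Icc 0 π) :
    IntervalIntegrable (gapDensity θ₀ θ₁) volume a b := by
  refine IntervalIntegrable.mono_set (a := 0) (b := π) ?_ ?_
  · refine (intervalIntegrable_singularBound h0 hπ).mono_fun
      (measurable_gapDensity θ₀ θ₁).aestronglyMeasurable (Eventually.of_forall fun t => ?_)
    simp only [Real.norm_of_nonneg (gapDensity_nonneg _ _ _)]
    exact (gapDensity_le_singularBound _ _ _).trans (le_abs_self _)
  · rw [uIcc_of_le pi_nonneg]
    exact uIcc_subset_Icc ha hb

lemma integral_pos_of_pos_on_Ioo {f : ℝ → ℝ} {a b c d : ℝ} (hac : a ≤ c) (hcd : c < d)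
    (hdb : d ≤ b) (hf : IntervalIntegrable f volume a b) (h0 : ∀ x ∈ Icc a b, 0 ≤ f x)
    (hpos : ∀ x ∈ Ioo c d, 0 < f x) : 0 < ∫ x in a..b, f x := by
  have hsub : ∀ p ∈ Icc a b, ∀ q ∈ Icc a b, IntervalIntegrable f volume p q := fun p hp q hq =>
    hf.mono_set (by rw [uIcc_of_le (by linarith : a ≤ b)]; exact uIcc_subset_Icc hp hq)
  have ma : a ∈ Icc a b := ⟨le_rfl, by linarith⟩
  have mc : c ∈ Icc a b := ⟨hac, by linarith⟩
  have md : d ∈ Icc a b := ⟨by linarith, hdb⟩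
  have mb : b ∈ Icc a b := ⟨by linarith, le_rfl⟩
  rw [← intervalIntegral.integral_add_adjacent_intervals (hsub a ma c mc) (hsub c mc b mb),
    ← intervalIntegral.integral_add_adjacent_intervals (hsub c mc d md) (hsub d md b mb)]
  have h1 : 0 ≤ ∫ x in a..c, f x :=
    intervalIntegral.integral_nonneg hac fun x hx => h0 x ⟨hx.1, hx.2.trans mc.2⟩
  have h2 : 0 ≤ ∫ x in d..b, f x :=
    intervalIntegral.integral_nonneg hdb fun x hx => h0 x ⟨md.1.trans hx.1, hx.2⟩
  have h3 : 0 < ∫ x in c..d, f x :=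
    intervalIntegral.intervalIntegral_pos_of_pos_on (hsub c mc d md) hpos hcd
  linarith

namespace Admissible

variable {θ₀ θ₁ : ℝ} (h : Admissible θ₀ θ₁)
include h

lemma cos_sub_pos_of_abs_lt {t : ℝ} (ht : |t| < θ₀) : 0 < Real.cos t - Real.cos θ₀ := by
  have h1 := Real.strictAntiOn_cos ⟨abs_nonneg t, by linarith [h.lt_pi]⟩
    ⟨h.pos.le, h.lt_pi.le⟩ ht
  rw [Real.cos_abs] at h1
  linarith

lemma cos_add_neg_of_abs_sub_lt {t : ℝ} (ht : |t - π| < θ₁) : Real.cos t + Real.cos θ₁ < 0 := by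
  have h1 := Real.strictAntiOn_cos ⟨abs_nonneg (t - π), by linarith [h.add_lt, h.pos]⟩
    ⟨h.nonneg, by linarith [h.add_lt, h.pos]⟩ ht
  rw [Real.cos_abs, Real.cos_sub_pi] at h1
  linarith

lemma gapDensity_eq_zero_of_abs_le {t : ℝ} (ht : |t| ≤ θ₀) : gapDensity θ₀ θ₁ t = 0 := by
  have h1 := Real.strictAntiOn_cos.antitoneOn ⟨abs_nonneg t, by linarith [h.lt_pi]⟩
    ⟨h.pos.le, h.lt_pi.le⟩ ht
  rw [Real.cos_abs] at h1
  refine Real.sqrt_eq_zero_of_nonpos (neg_nonpos.2 (div_nonneg ?_ (by linarith)))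
  linarith [h.cos_add_cos_pos]

lemma gapDensity_eq_zero_of_abs_sub_le {t : ℝ} (ht : |t - π| ≤ θ₁) : gapDensity θ₀ θ₁ t = 0 := by
  have h1 := Real.strictAntiOn_cos.antitoneOn ⟨abs_nonneg (t - π), by linarith [h.add_lt, h.pos]⟩
    ⟨h.nonneg, by linarith [h.add_lt, h.pos]⟩ ht
  rw [Real.cos_abs, Real.cos_sub_pi] at h1
  refine Real.sqrt_eq_zero_of_nonpos (neg_nonpos.2 (div_nonneg_of_nonpos ?_ ?_))
  · linarith
  · linarith [h.cos_add_cos_pos]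

lemma twoArcDensity_pos_of_abs_lt {t : ℝ} (ht : |t| < θ₀) : 0 < twoArcDensity θ₀ θ₁ t := by
  have h1 := h.cos_sub_pos_of_abs_lt ht
  exact mul_pos (by positivity)
    (Real.sqrt_pos.2 (div_pos (by linarith [h.cos_add_cos_pos]) h1))

lemma twoArcDensity_pos_of_abs_sub_lt {t : ℝ} (ht : |t - π| < θ₁) :
    0 < twoArcDensity θ₀ θ₁ t := by
  have h1 := h.cos_add_neg_of_abs_sub_lt ht
  exact mul_pos (by positivity)
    (Real.sqrt_pos.2 (div_pos_of_neg_of_neg h1 (by linarith [h.cos_add_cos_pos])))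

lemma cos_add_pos_and_cos_sub_neg {t : ℝ} (h1 : θ₀ < t) (h2 : t < π - θ₁) :
    0 < Real.cos t + Real.cos θ₁ ∧ Real.cos t - Real.cos θ₀ < 0 := by
  have h3 := Real.strictAntiOn_cos ⟨h.pos.le, h.lt_pi.le⟩
    ⟨by linarith [h.pos], by linarith [h.nonneg]⟩ h1
  have h4 := Real.strictAntiOn_cos ⟨by linarith [h.pos], by linarith [h.nonneg]⟩
    ⟨by linarith [h.add_lt, h.pos], by linarith [h.nonneg]⟩ h2
  rw [Real.cos_pi_sub] at h4
  constructor <;> linarith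

lemma gapDensity_pos {t : ℝ} (h1 : θ₀ < t) (h2 : t < π - θ₁) : 0 < gapDensity θ₀ θ₁ t := by
  obtain ⟨h3, h4⟩ := h.cos_add_pos_and_cos_sub_neg h1 h2
  exact Real.sqrt_pos.2 (neg_pos.2 (div_neg_of_pos_of_neg h3 h4))

lemma intervalIntegrable_gapDensity {a b : ℝ} (ha : a ∈ Icc 0 π) (hb : b ∈ Icc 0 π) :
    IntervalIntegrable (gapDensity θ₀ θ₁) volume a b :=
  CircleEquilibrium.intervalIntegrable_gapDensity h.pos h.lt_pi θ₁ ha hb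

lemma integral_gapDensity_eq_zero {φ : ℝ} (h0 : 0 ≤ φ) (hφ : φ ≤ θ₀) :
    ∫ t in (0 : ℝ)..φ, gapDensity θ₀ θ₁ t = 0 := by
  rw [intervalIntegral.integral_congr (g := fun _ => 0)]
  · simp
  · intro t ht
    rw [uIcc_of_le h0] at ht
    exact h.gapDensity_eq_zero_of_abs_le (by rw [abs_of_nonneg ht.1]; linarith [ht.2])

lemma integral_gapDensity_add {φ : ℝ} (h0 : 0 ≤ φ) (hπ : φ ≤ π) :
    (∫ t in (0 : ℝ)..φ, gapDensity θ₀ θ₁ t) +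
    ∫ t in φ..π, gapDensity θ₀ θ₁ t = gapIntegral θ₀ θ₁ :=
  intervalIntegral.integral_add_adjacent_intervals
    (h.intervalIntegrable_gapDensity ⟨le_rfl, pi_nonneg⟩ ⟨h0, hπ⟩)
    (h.intervalIntegrable_gapDensity ⟨h0, hπ⟩ ⟨pi_nonneg, le_rfl⟩)

lemma integral_gapDensity_le {φ : ℝ} (h0 : 0 ≤ φ) (hπ : φ ≤ π) :
    ∫ t in (0 : ℝ)..φ, gapDensity θ₀ θ₁ t ≤ gapIntegral θ₀ θ₁ := by
  rw [← h.integral_gapDensity_add h0 hπ, le_add_iff_nonneg_right]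
  exact intervalIntegral.integral_nonneg hπ fun t _ => gapDensity_nonneg _ _ _

lemma integral_gapDensity_lt {φ : ℝ} (h0 : 0 ≤ φ) (hφ : φ < π - θ₁) :
    ∫ t in (0 : ℝ)..φ, gapDensity θ₀ θ₁ t < gapIntegral θ₀ θ₁ := by
  have hπ : φ ≤ π := by linarith [h.nonneg]
  rw [← h.integral_gapDensity_add h0 hπ, lt_add_iff_pos_right]
  refine integral_pos_of_pos_on_Ioo (le_max_left φ θ₀) (max_lt hφ (by linarith [h.add_lt]))
    (by linarith [h.nonneg]) (h.intervalIntegrable_gapDensity ⟨h0, hπ⟩ ⟨pi_nonneg, le_rfl⟩)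
    (fun t _ => gapDensity_nonneg _ _ _) fun t ht => ?_
  exact h.gapDensity_pos ((le_max_right _ _).trans_lt ht.1) ht.2

lemma integral_gapDensity_eq {φ : ℝ} (hφ : π - θ₁ ≤ φ) (hπ : φ ≤ π) :
    ∫ t in (0 : ℝ)..φ, gapDensity θ₀ θ₁ t = gapIntegral θ₀ θ₁ := by
  rw [← h.integral_gapDensity_add (by linarith [h.add_lt, h.pos]) hπ, eq_comm, add_eq_left,
    intervalIntegral.integral_congr (g := fun _ => 0)]
  · simp
  · intro t ht
    rw [uIcc_of_le hπ] at ht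
    exact h.gapDensity_eq_zero_of_abs_sub_le
      (by rw [abs_of_nonpos (by linarith [ht.2])]; linarith [ht.1])

end Admissible

/-- Increasing `θ₁` decreases the integrand, strictly so where it was positive. -/
lemma gapIntegral_strictAntiOn {θ₀ : ℝ} (h0 : 0 < θ₀) (hπ : θ₀ < π) :
    StrictAntiOn (gapIntegral θ₀) (Icc 0 (π - θ₀)) := by
  intro s hs t ht hst
  have h : Admissible θ₀ s := ⟨h0, hπ, hs.1, by linarith [ht.2]⟩
  have hcos : Real.cos t < Real.cos s :=
    Real.strictAntiOn_cos ⟨hs.1, by linarith [hs.2]⟩ ⟨ht.1, by linarith [ht.2]⟩ hst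
  have hi := fun θ₁ => intervalIntegrable_gapDensity h0 hπ θ₁ (a := 0) (b := π)
    ⟨le_rfl, pi_nonneg⟩ ⟨pi_nonneg, le_rfl⟩
  rw [← sub_pos, gapIntegral, gapIntegral, ← intervalIntegral.integral_sub (hi s) (hi t)]
  refine integral_pos_of_pos_on_Ioo (c := θ₀) (d := π - s) h0.le (by linarith [h.add_lt])
    (by linarith [hs.1]) ((hi s).sub (hi t)) (fun x hx => ?_) fun x hx => ?_
  · rcases lt_trichotomy x θ₀ with h1 | h1 | h1
    · have h2 := h.cos_sub_pos_of_abs_lt (t := x) (by rwa [abs_of_nonneg hx.1])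
      have h3 : gapDensity θ₀ t x = 0 := by
        refine Real.sqrt_eq_zero_of_nonpos (neg_nonpos.2 (div_nonneg ?_ h2.le))
        have h4 := Real.strictAntiOn_cos.antitoneOn ⟨ht.1, by linarith [ht.2]⟩
          ⟨by linarith, by linarith⟩ ht.2
        rw [Real.cos_pi_sub] at h4
        linarith
      rw [h3, sub_zero]
      exact gapDensity_nonneg _ _ _
    · simp [gapDensity, circleRatio, h1]
    · have h2 := Real.strictAntiOn_cos ⟨h0.le, hπ.le⟩ hx h1
      rw [sub_nonneg]
      refine Real.sqrt_le_sqrt (neg_le_neg ?_)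
      exact div_le_div_of_nonpos_of_le (by linarith) (by linarith)
  · obtain ⟨h1, h2⟩ := h.cos_add_pos_and_cos_sub_neg hx.1 hx.2
    rw [sub_pos]
    refine (Real.sqrt_lt_sqrt_iff_of_pos (neg_pos.2 (div_neg_of_pos_of_neg h1 h2))).2 ?_
    exact neg_lt_neg (div_lt_div_of_neg_of_lt h2 (by linarith))

lemma continuous_gapIntegral {θ₀ : ℝ} (h0 : 0 < θ₀) (hπ : θ₀ < π) :
    Continuous (gapIntegral θ₀) := by
  refine intervalIntegral.continuous_of_dominated_interval
    (bound := singularBound (Real.cos θ₀))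
    (fun θ₁ => (measurable_gapDensity θ₀ θ₁).aestronglyMeasurable) (fun θ₁ => ?_)
    (intervalIntegrable_singularBound h0 hπ) (Eventually.of_forall fun t _ => ?_)
  · refine Eventually.of_forall fun t _ => ?_
    rw [Real.norm_of_nonneg (gapDensity_nonneg _ _ _)]
    exact gapDensity_le_singularBound _ _ _
  · unfold gapDensity circleRatio
    fun_prop

/-- When the gap closes, the quotient is identically `1` (or `0 / 0`), so the increment vanishes. -/
lemma gapIntegral_pi_sub (θ₀ : ℝ) : gapIntegral θ₀ (π - θ₀) = 0 := by
  have h : ∀ t, gapDensity θ₀ (π - θ₀) t = 0 := fun t => by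
    refine Real.sqrt_eq_zero_of_nonpos (neg_nonpos.2 ?_)
    rw [circleRatio, Real.cos_pi_sub, ← sub_eq_add_neg]
    rcases eq_or_ne (Real.cos t - Real.cos θ₀) 0 with h | h
    · simp [h]
    · rw [div_self h]
      exact zero_le_one
  simp [gapIntegral, h]

/-- The critical value `x_c` is the increment of the potential when the second arc degenerates to
the point `-1`. With `k = sin (θ₀ / 2)` the integrand is `cos (t / 2) / √(sin² (t / 2) - k²)`, which
has an elementary primitive. -/
lemma gapIntegral_zero {θ₀ : ℝ} (h0 : 0 < θ₀) (hπ : θ₀ < π) : gapIntegral θ₀ 0 = xCrit θ₀ := by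
  have h : Admissible θ₀ 0 := ⟨h0, hπ, le_rfl, by linarith⟩
  set k := Real.sin (θ₀ / 2) with hk
  have hk0 : 0 < k := Real.sin_pos_of_pos_of_lt_pi (by linarith) (by linarith)
  have hcos : 0 < Real.cos (θ₀ / 2) := Real.cos_pos_of_mem_Ioo ⟨by linarith, by linarith⟩
  have hS : ∀ t ∈ Icc θ₀ π, k ≤ Real.sin (t / 2) := fun t ht =>
    Real.strictMonoOn_sin.monotoneOn ⟨by linarith, by linarith⟩
      ⟨by linarith [ht.1], by linarith [ht.2]⟩ (by linarith [ht.1])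
  have hint : IntervalIntegrable (gapDensity θ₀ 0) volume θ₀ π :=
    h.intervalIntegrable_gapDensity ⟨h0.le, hπ.le⟩ ⟨pi_nonneg, le_rfl⟩
  have hFTC : ∫ t in θ₀..π, gapDensity θ₀ 0 t =
      2 * Real.log (Real.sin (π / 2) + √(Real.sin (π / 2) ^ 2 - k ^ 2)) -
        2 * Real.log (Real.sin (θ₀ / 2) + √(Real.sin (θ₀ / 2) ^ 2 - k ^ 2)) := by
    refine intervalIntegral.integral_eq_sub_of_hasDerivAt_of_le hπ.le
      (f := fun t => 2 * Real.log (Real.sin (t / 2) + √(Real.sin (t / 2) ^ 2 - k ^ 2))) ?_ ?_ hint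
    · refine continuousOn_const.mul (ContinuousOn.log (by fun_prop) fun t ht => ?_)
      have : 0 < Real.sin (t / 2) := hk0.trans_le (hS t ht)
      positivity
    · intro t ht
      have h1 : k < Real.sin (t / 2) := Real.strictMonoOn_sin ⟨by linarith, by linarith⟩
        ⟨by linarith [ht.1], by linarith [ht.2]⟩ (by linarith [ht.1])
      have h2 : 0 < Real.sin (t / 2) ^ 2 - k ^ 2 := by nlinarith
      have hc : 0 < Real.cos (t / 2) := Real.cos_pos_of_mem_Ioo
        ⟨by linarith [ht.1], by linarith [ht.2]⟩
      have hd : HasDerivAt (fun t : ℝ => Real.sin (t / 2)) (Real.cos (t / 2) * (1 / 2)) t :=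
        ((hasDerivAt_id t).div_const 2).sin
      have hS0 : 0 < Real.sin (t / 2) := hk0.trans h1
      have hd1 : HasDerivAt (fun t : ℝ => Real.sin (t / 2) ^ 2 - k ^ 2)
          (2 * Real.sin (t / 2) * (Real.cos (t / 2) * (1 / 2))) t := by
        simpa using (hd.fun_pow 2).sub_const (k ^ 2)
      have hd2 := ((hd.fun_add (hd1.sqrt h2.ne')).log (by positivity)).const_mul 2
      refine HasDerivAt.congr_deriv hd2 ?_
      have hval : gapDensity θ₀ 0 t = Real.cos (t / 2) / √(Real.sin (t / 2) ^ 2 - k ^ 2) := by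
        have e1 : Real.cos t + Real.cos 0 = 2 * Real.cos (t / 2) ^ 2 := by
          rw [Real.cos_zero, Real.cos_sq]
          ring_nf
        have e2 : Real.cos t - Real.cos θ₀ = -(2 * (Real.sin (t / 2) ^ 2 - k ^ 2)) := by
          rw [hk, Real.sin_sq_eq_half_sub, Real.sin_sq_eq_half_sub]
          ring_nf
        rw [gapDensity, circleRatio, e1, e2, div_neg, neg_neg, mul_div_mul_left _ _ two_ne_zero,
          Real.sqrt_div (by positivity), Real.sqrt_sq hc.le]
      rw [hval]
      have hq := Real.sqrt_pos.2 h2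
      have hsum : Real.sin (t / 2) + √(Real.sin (t / 2) ^ 2 - k ^ 2) ≠ 0 := by positivity
      field_simp
      ring
  rw [← h.integral_gapDensity_add h0.le hπ.le, h.integral_gapDensity_eq_zero h0.le le_rfl, zero_add,
    hFTC, Real.sin_pi_div_two, ← hk, sub_self, Real.sqrt_zero, add_zero, xCrit]
  have e3 : √(1 ^ 2 - k ^ 2) = Real.cos (θ₀ / 2) := by
    rw [one_pow, hk, ← Real.cos_sq', Real.sqrt_sq hcos.le]
  have e4 : Real.tan (θ₀ / 4) = k / (1 + Real.cos (θ₀ / 2)) := by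
    have hc4 : 0 < Real.cos (θ₀ / 4) := Real.cos_pos_of_mem_Ioo ⟨by linarith, by linarith⟩
    have e5 : θ₀ / 2 = 2 * (θ₀ / 4) := by ring
    rw [hk, e5, Real.sin_two_mul, Real.cos_two_mul, Real.tan_eq_sin_div_cos]
    field_simp
    ring
  rw [e3, e4, Real.log_div hk0.ne' (by positivity)]
  ring

/-- The constant in the variational conditions in the one-arc case, from an explicit primitive. -/
lemma integral_ellIntegrand_zero {θ₀ : ℝ} (h0 : 0 < θ₀) (hπ : θ₀ < π) :
    ∫ s in (0 : ℝ)..1, ellIntegrand θ₀ 0 s = 2 * Real.log (Real.sin (θ₀ / 2)) := by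
  have h : Admissible θ₀ 0 := ⟨h0, hπ, le_rfl, by linarith⟩
  set c := Real.cos θ₀ with hc
  have hc1 : c < 1 := h.cos_lt_one
  have hc2 : -1 < c := by
    have := h.cos_add_cos_pos
    rw [Real.cos_zero] at this
    linarith
  have hk0 : 0 < Real.sin (θ₀ / 2) := Real.sin_pos_of_pos_of_lt_pi (by linarith) (by linarith)
  have hD : ∀ s : ℝ, 0 < s ^ 2 - 2 * c * s + 1 := fun s => by nlinarith [sq_nonneg (s - c)]
  have hA : ∀ s ∈ Icc (0 : ℝ) 1, 0 < 1 - c * s + √(s ^ 2 - 2 * c * s + 1) := fun s hs => by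
    have := Real.sqrt_pos.2 (hD s)
    nlinarith [hs.1, hs.2]
  have hB : ∀ s : ℝ, 0 < s - c + √(s ^ 2 - 2 * c * s + 1) := fun s => by
    have : |s - c| < √(s ^ 2 - 2 * c * s + 1) := by
      rw [← Real.sqrt_sq_eq_abs]
      exact Real.sqrt_lt_sqrt (sq_nonneg _) (by nlinarith)
    linarith [neg_abs_le (s - c)]
  rw [intervalIntegral.integral_eq_sub_of_hasDerivAt_of_le zero_le_one
    (f := fun s => Real.log (1 - c * s + √(s ^ 2 - 2 * c * s + 1)) -
      Real.log (s - c + √(s ^ 2 - 2 * c * s + 1))) ?_ ?_ h.intervalIntegrable_ellIntegrand]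
  · have e1 : (1 : ℝ) - c * 0 + √(0 ^ 2 - 2 * c * 0 + 1) = 2 := by norm_num
    have e2 : (0 : ℝ) - c + √(0 ^ 2 - 2 * c * 0 + 1) = 2 * Real.sin (θ₀ / 2) ^ 2 := by
      rw [Real.sin_sq_eq_half_sub, show 2 * (θ₀ / 2) = θ₀ by ring, ← hc]
      norm_num
      ring
    rw [e1, e2, mul_one, sub_self, Real.log_mul two_ne_zero (by positivity), Real.log_pow]
    push_cast
    ring
  · refine ContinuousOn.sub ?_ ?_
    · exact ContinuousOn.log (by fun_prop) fun s hs => (hA s hs).ne'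
    · exact ContinuousOn.log (by fun_prop) fun s _ => (hB s).ne'
  · intro s hs
    have hDs := hD s
    have hAs := hA s ⟨hs.1.le, hs.2.le⟩
    have hBs := hB s
    have hpoly : HasDerivAt (fun s : ℝ => s ^ 2 - 2 * c * s + 1) (2 * s - 2 * c) s := by
      have := (((hasDerivAt_id s).pow 2).sub ((hasDerivAt_id s).const_mul (2 * c))).add_const 1
      simpa using this
    have hsq := hpoly.sqrt hDs.ne'
    have h1 := ((((hasDerivAt_id s).const_mul c).const_sub 1).add hsq).log hAs.ne'
    have h2 := (((hasDerivAt_id s).sub_const c).add hsq).log hBs.ne'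
    refine HasDerivAt.congr_deriv (h1.sub h2) ?_
    have hval : ellIntegrand θ₀ 0 s = 1 / s * (1 - (1 + s) / √(s ^ 2 - 2 * c * s + 1)) := by
      rw [ellIntegrand, Real.cos_zero, show s ^ 2 + 2 * 1 * s + 1 = (1 + s) ^ 2 by ring, ← hc,
        Real.sqrt_div (sq_nonneg _), Real.sqrt_sq (by linarith [hs.1])]
    rw [hval]
    have hq0 := Real.sqrt_pos.2 hDs
    have hq2 := Real.sq_sqrt hDs.le
    have hs0 := hs.1.ne'
    simp only [id, Pi.add_apply]
    set q := √(s ^ 2 - 2 * c * s + 1)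
    have e1 : (-(c * 1) + (2 * s - 2 * c) / (2 * q)) / (1 - c * s + q) = 1 / s * (1 - 1 / q) := by
      field_simp
      linear_combination (-1 : ℝ) * hq2
    have e2 : (1 + (2 * s - 2 * c) / (2 * q)) / (s - c + q) = 1 / q := by
      field_simp
      ring
    rw [e1, e2]
    field_simp
    ring

/-! ### Arcs and supports -/

lemma cos_eq_of_circleExp_eq {s t : ℝ} (h : Circle.exp s = Circle.exp t) :
    Real.cos s = Real.cos t := by
  have := congrArg (fun z : Circle => (z : ℂ).re) h
  simpa [Circle.coe_exp, Complex.exp_ofReal_mul_I_re] using this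

/-- Every point of the circle has an angle in `[-π, π]`, in terms of which membership in the two
arcs is a condition on the absolute value of the angle. -/
lemma exists_circleExp_eq (z : Circle) : ∃ φ : ℝ, |φ| ≤ π ∧ Circle.exp φ = z :=
  ⟨(z : ℂ).arg, Complex.abs_arg_le_pi _, Circle.exp_arg z⟩

lemma circleExp_mem_gammaArc_iff {θ₀ φ : ℝ} (hθ₀ : θ₀ ≤ π) (hφ : |φ| ≤ π) :
    Circle.exp φ ∈ gammaArc θ₀ ↔ |φ| ≤ θ₀ := by
  constructor
  · rintro ⟨t, ht, hexp⟩
    have h1 : |t| ≤ θ₀ := abs_le.2 ht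
    have h2 := cos_eq_of_circleExp_eq hexp
    rw [← Real.cos_abs t, ← Real.cos_abs φ] at h2
    rw [← Real.injOn_cos ⟨abs_nonneg t, h1.trans hθ₀⟩ ⟨abs_nonneg φ, hφ⟩ h2]
    exact h1
  · exact fun h => ⟨φ, abs_le.1 h, rfl⟩

lemma circleExp_mem_arcSet_iff {θ₁ φ : ℝ} (hθ₁ : θ₁ ≤ π) (hφ : |φ| ≤ π) :
    Circle.exp φ ∈ arcSet (Icc (π - θ₁) (π + θ₁)) ↔ π - θ₁ ≤ |φ| := by
  constructor
  · rintro ⟨t, ht, hexp⟩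
    have h1 : |t - π| ≤ θ₁ := abs_le.2 ⟨by linarith [ht.1], by linarith [ht.2]⟩
    have h2 := cos_eq_of_circleExp_eq hexp
    rw [← Real.cos_abs φ, ← neg_inj, ← Real.cos_sub_pi, ← Real.cos_abs (t - π),
      ← Real.cos_pi_sub] at h2
    have h3 := Real.injOn_cos ⟨abs_nonneg _, h1.trans hθ₁⟩
      ⟨by linarith, by linarith [abs_nonneg φ]⟩ h2
    linarith
  · intro h
    rcases le_total 0 φ with h0 | h0
    · rw [abs_of_nonneg h0] at h hφ
      exact ⟨φ, ⟨h, by linarith⟩, rfl⟩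
    · rw [abs_of_nonpos h0] at h hφ
      exact ⟨φ + 2 * π, ⟨by linarith, by linarith⟩, Circle.periodic_exp φ⟩

lemma arcSet_union (A B : Set ℝ) : arcSet (A ∪ B) = arcSet A ∪ arcSet B := image_union _ _ _

lemma isClosed_arcSet_Icc (a b : ℝ) : IsClosed (arcSet (Icc a b)) :=
  (isCompact_Icc.image Circle.exp.continuous).isClosed

lemma angularMeasure_compl_arcSet {A : Set ℝ} (v : ℝ → ℝ)
    (hc : IsClosed (arcSet A)) : angularMeasure A v (arcSet A)ᶜ = 0 := by
  rw [angularMeasure, Measure.map_apply measurable_circleExp hc.measurableSet.compl]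
  refine withDensity_absolutelyContinuous _ _ ?_
  rw [Measure.restrict_apply (measurable_circleExp hc.measurableSet.compl)]
  convert measure_empty (μ := (volume : Measure ℝ))
  ext θ
  simp only [mem_inter_iff, mem_preimage, mem_compl_iff, mem_empty_iff_false, iff_false, not_and]
  exact fun h1 h2 => h1 ⟨θ, h2, rfl⟩

/-- The closure of an open arc on which the density is positive belongs to the support. -/
lemma arcSet_Icc_subset_support {A : Set ℝ} {v : ℝ → ℝ} (hv : Measurable v) {a b : ℝ}
    (hab : a < b) (hA : Ioo a b ⊆ A) (hpos : ∀ θ ∈ Ioo a b, 0 < v θ) :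
    arcSet (Icc a b) ⊆ (angularMeasure A v).support := by
  have hIoo : arcSet (Ioo a b) ⊆ (angularMeasure A v).support := by
    rintro _ ⟨θ, hθ, rfl⟩
    rw [Measure.mem_support_iff_forall]
    intro U hU
    rw [pos_iff_ne_zero]
    intro h0
    obtain ⟨W, hWU, hW, hθW⟩ := mem_nhds_iff.1 hU
    have h1 : angularMeasure A v W = 0 := measure_mono_null hWU h0
    rw [angularMeasure, Measure.map_apply measurable_circleExp hW.measurableSet,
      withDensity_apply_eq_zero hv.ennreal_ofReal] at h1
    have hopen : IsOpen (Ioo a b ∩ Circle.exp ⁻¹' W) :=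
      isOpen_Ioo.inter (hW.preimage Circle.exp.continuous)
    have h2 : 0 < volume (Ioo a b ∩ Circle.exp ⁻¹' W) := hopen.measure_pos _ ⟨θ, hθ, hθW⟩
    have h3 : (volume.restrict A) (Ioo a b ∩ Circle.exp ⁻¹' W) = 0 := by
      have hsub : Ioo a b ∩ Circle.exp ⁻¹' W ⊆
          {x | ENNReal.ofReal (v x) ≠ 0} ∩ Circle.exp ⁻¹' W :=
        fun t ht => ⟨(ENNReal.ofReal_pos.2 (hpos t ht.1)).ne', ht.2⟩
      exact measure_mono_null hsub h1
    rw [Measure.restrict_apply hopen.measurableSet,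
      inter_eq_left.2 (inter_subset_left.trans hA)] at h3
    exact h2.ne' h3
  rw [← closure_Ioo hab.ne]
  exact (image_closure_subset_closure_image Circle.exp.continuous).trans
    (closure_minimal hIoo Measure.isClosed_support)

namespace Admissible

variable {θ₀ θ₁ : ℝ} (h : Admissible θ₀ θ₁)
include h

lemma gammaArc_subset_support : gammaArc θ₀ ⊆ (twoArcMeasure θ₀ θ₁).support :=
  arcSet_Icc_subset_support (measurable_twoArcDensity θ₀ θ₁) (by linarith [h.pos])
    (fun _ hθ => Or.inl ⟨hθ.1.le, hθ.2.le⟩)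
    fun _ hθ => h.twoArcDensity_pos_of_abs_lt (abs_lt.2 hθ)

lemma support_twoArcMeasure (h1 : 0 < θ₁) :
    (twoArcMeasure θ₀ θ₁).support = arcSet (twoArcAngles θ₀ θ₁) := by
  have hc : IsClosed (arcSet (twoArcAngles θ₀ θ₁)) := by
    rw [twoArcAngles, arcSet_union]
    exact (isClosed_arcSet_Icc _ _).union (isClosed_arcSet_Icc _ _)
  refine subset_antisymm (Measure.support_subset_of_isClosed hc (compl_mem_ae_iff.1 ?_)) ?_
  · simpa [mem_ae_iff] using angularMeasure_compl_arcSet _ hc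
  · rw [twoArcAngles, arcSet_union]
    refine union_subset h.gammaArc_subset_support ?_
    exact arcSet_Icc_subset_support (measurable_twoArcDensity θ₀ θ₁) (by linarith)
      (fun _ hθ => Or.inr ⟨hθ.1.le, hθ.2.le⟩)
      fun _ hθ => h.twoArcDensity_pos_of_abs_sub_lt
        (abs_lt.2 ⟨by linarith [hθ.1], by linarith [hθ.2]⟩)

end Admissible

/-- A second arc degenerated to the point `-1` carries no mass. -/
lemma angularMeasure_oneArc (θ₀ : ℝ) :
    angularMeasure (Icc (-θ₀) θ₀) (oneArcDensity θ₀) = twoArcMeasure θ₀ 0 := by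
  have h1 : (twoArcAngles θ₀ 0 : Set ℝ) =ᵐ[volume] Icc (-θ₀) θ₀ := by
    rw [twoArcAngles, sub_zero, add_zero, Icc_self]
    exact union_ae_eq_left_of_ae_eq_empty (ae_eq_empty.2 (measure_singleton π))
  have h2 : oneArcDensity θ₀ = twoArcDensity θ₀ 0 := by
    ext θ
    simp [oneArcDensity, twoArcDensity]
  rw [twoArcMeasure, angularMeasure, angularMeasure, Measure.restrict_congr_set h1, h2]

/-! ### The variational conditions -/

lemma measurable_potential (θ₀ : ℝ) (x : EReal) : Measurable (potential θ₀ x) := by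
  classical
  unfold potential
  exact Measurable.ite (isClosed_arcSet_Icc _ _).measurableSet measurable_const measurable_const

namespace Admissible

variable {θ₀ θ₁ : ℝ} (h : Admissible θ₀ θ₁)
include h

/-- The left-hand side of the variational conditions, from the potential of `μ`. -/
lemma eulerLagrange_eq (V : Circle → EReal) (ℓ' : ℝ) {φ : ℝ} (hφ : |φ| ≤ π) :
    eulerLagrange V (twoArcMeasure θ₀ θ₁) ℓ' (Circle.exp φ) =
      (((∫ s in (0 : ℝ)..1, ellIntegrand θ₀ θ₁ s) +
        ∫ t in (0 : ℝ)..|φ|, gapDensity θ₀ θ₁ t : ℝ) : EReal) - V (Circle.exp φ) + ℓ' := by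
  obtain ⟨hint, hval⟩ := h.integral_log_twoArcMeasure hφ
  have hne : ∀ᵐ s ∂twoArcMeasure θ₀ θ₁, logDist (Circle.exp φ) s =
      ((Real.log ‖(Circle.exp φ : ℂ) - s‖ : ℝ) : EReal) := by
    filter_upwards [compl_mem_ae_iff.2
      (measure_singleton (μ := twoArcMeasure θ₀ θ₁) (Circle.exp φ))] with s hs
    exact logDist_of_ne fun h' => hs h'.symm
  rw [eulerLagrange, coe_extIntegral hint hne]
  have h2 : (2 : EReal) * ((∫ s : Circle, Real.log ‖(Circle.exp φ : ℂ) - s‖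
      ∂twoArcMeasure θ₀ θ₁ : ℝ) : EReal) = ((2 * ∫ s : Circle, Real.log ‖(Circle.exp φ : ℂ) - s‖
      ∂twoArcMeasure θ₀ θ₁ : ℝ) : EReal) := by
    rw [EReal.coe_mul]
    rfl
  rw [h2, hval]
  rfl

/-- If the field dominates the increment of the potential, with equality on the support, then the
measure is the equilibrium measure and the variational conditions determine the constant. -/
lemma equilibrium {V : Circle → EReal} (hVm : Measurable V) (hV0 : ∀ z, 0 ≤ V z)
    (hle : ∀ φ : ℝ, |φ| ≤ π →
      ((∫ t in (0 : ℝ)..|φ|, gapDensity θ₀ θ₁ t : ℝ) : EReal) ≤ V (Circle.exp φ))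
    (heq : ∀ φ : ℝ, |φ| ≤ π → Circle.exp φ ∈ (twoArcMeasure θ₀ θ₁).support →
      V (Circle.exp φ) = ((∫ t in (0 : ℝ)..|φ|, gapDensity θ₀ θ₁ t : ℝ) : EReal)) :
    (∀ ν : Measure Circle, IsEquilibriumMeasure V ν ↔ ν = twoArcMeasure θ₀ θ₁) ∧
    ∀ ℓ' : ℝ, SatisfiesEulerLagrange V (twoArcMeasure θ₀ θ₁) ℓ' ↔
      ℓ' = -∫ s in (0 : ℝ)..1, ellIntegrand θ₀ θ₁ s := by
  have := h.isProbabilityMeasure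
  set L := ∫ s in (0 : ℝ)..1, ellIntegrand θ₀ θ₁ s with hL
  have hpot : ∀ φ : ℝ, |φ| ≤ π → 2 * ∫ s : Circle, Real.log ‖(Circle.exp φ : ℂ) - s‖
      ∂twoArcMeasure θ₀ θ₁ = L + ∫ t in (0 : ℝ)..|φ|, gapDensity θ₀ θ₁ t := fun φ hφ =>
    (h.integral_log_twoArcMeasure hφ).2
  have hnn : ∀ φ : ℝ, 0 ≤ ∫ t in (0 : ℝ)..|φ|, gapDensity θ₀ θ₁ t := fun φ =>
    intervalIntegral.integral_nonneg (abs_nonneg φ) fun t _ => gapDensity_nonneg _ _ _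
  refine ⟨isEquilibriumMeasure_iff_eq (ℓ := -L) (C := (|L| + gapIntegral θ₀ θ₁) / 2) hVm hV0
    (fun z => ?_) (fun z => ?_) (fun z => ?_) ?_, fun ℓ' => ⟨fun hEL => ?_, ?_⟩⟩
  · obtain ⟨φ, hφ, rfl⟩ := exists_circleExp_eq z
    exact (h.integral_log_twoArcMeasure hφ).1
  · obtain ⟨φ, hφ, rfl⟩ := exists_circleExp_eq z
    have h1 := hpot φ hφ
    have h2 := h.integral_gapDensity_le (abs_nonneg φ) hφ
    have h3 := hnn φ
    rw [abs_le]
    constructor <;> linarith [le_abs_self L, neg_abs_le L]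
  · obtain ⟨φ, hφ, rfl⟩ := exists_circleExp_eq z
    rw [hpot φ hφ, add_comm L, add_neg_cancel_right]
    exact hle φ hφ
  · filter_upwards [Measure.support_mem_ae (μ := twoArcMeasure θ₀ θ₁)] with z hz
    obtain ⟨φ, hφ, rfl⟩ := exists_circleExp_eq z
    rw [hpot φ hφ, add_comm L, add_neg_cancel_right]
    exact heq φ hφ hz
  · -- the constant is determined at the point `1` of the support
    have h0 : |(0 : ℝ)| ≤ π := by simpa using pi_nonneg
    have hmem : Circle.exp 0 ∈ (twoArcMeasure θ₀ θ₁).support :=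
      h.gammaArc_subset_support ⟨0, ⟨by linarith [h.pos], h.pos.le⟩, rfl⟩
    have h1 := hEL.1 _ hmem
    rw [h.eulerLagrange_eq V ℓ' h0, heq 0 h0 hmem, ← EReal.coe_sub, ← EReal.coe_add,
      add_sub_cancel_right] at h1
    have h2 : L + ℓ' = 0 := by exact_mod_cast h1
    linarith
  · rintro rfl
    have key : ∀ φ : ℝ, |φ| ≤ π → Circle.exp φ ∈ (twoArcMeasure θ₀ θ₁).support →
        eulerLagrange V (twoArcMeasure θ₀ θ₁) (-L) (Circle.exp φ) = 0 := fun φ hφ hmem => by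
      rw [h.eulerLagrange_eq V _ hφ, heq φ hφ hmem, ← EReal.coe_sub, ← EReal.coe_add, ← hL,
        add_sub_cancel_right, add_neg_cancel, EReal.coe_zero]
    refine ⟨fun z hz => ?_, fun z hz => ?_⟩
    · obtain ⟨φ, hφ, rfl⟩ := exists_circleExp_eq z
      exact key φ hφ hz
    · obtain ⟨φ, hφ, rfl⟩ := exists_circleExp_eq z
      rw [h.eulerLagrange_eq V _ hφ]
      have h1 := hle φ hφ
      generalize V (Circle.exp φ) = y at h1
      induction y with
      | bot => exact absurd h1 (by simp)
      | top => simp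
      | coe y =>
        rw [EReal.coe_le_coe_iff] at h1
        rw [← EReal.coe_sub, ← EReal.coe_add, ← EReal.coe_zero, EReal.coe_le_coe_iff]
        linarith

/-- Strictness of the variational inequality where the field exceeds the increment. -/
lemma eulerLagrange_neg {V : Circle → EReal} {φ : ℝ} (hφ : |φ| ≤ π)
    (hlt : ((∫ t in (0 : ℝ)..|φ|, gapDensity θ₀ θ₁ t : ℝ) : EReal) < V (Circle.exp φ)) :
    eulerLagrange V (twoArcMeasure θ₀ θ₁) (-∫ s in (0 : ℝ)..1, ellIntegrand θ₀ θ₁ s)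
      (Circle.exp φ) < 0 := by
  rw [h.eulerLagrange_eq V _ hφ]
  generalize V (Circle.exp φ) = y at hlt
  induction y with
  | bot => exact absurd hlt (by simp)
  | top => simp
  | coe y =>
    rw [EReal.coe_lt_coe_iff] at hlt
    rw [← EReal.coe_sub, ← EReal.coe_add, ← EReal.coe_zero, EReal.coe_lt_coe_iff]
    linarith

/-- The endpoint equation prescribes the increment of the potential between `1` and `-1`. -/
lemma endpointEquation_iff (x : ℝ) : EndpointEquation θ₀ x θ₁ ↔ gapIntegral θ₀ θ₁ = x := by
  have := h.isProbabilityMeasure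
  have h0 : |(0 : ℝ)| ≤ π := by simpa using pi_nonneg
  have hπ : |π| ≤ π := (abs_of_nonneg pi_nonneg).le
  obtain ⟨i1, v1⟩ := h.integral_log_twoArcMeasure h0
  obtain ⟨i2, v2⟩ := h.integral_log_twoArcMeasure hπ
  have hm : StronglyMeasurable fun s : Circle => Real.log ‖(1 + (s : ℂ)) / (1 - (s : ℂ))‖ := by
    have h1 : Measurable fun s : Circle => (s : ℂ) :=
      (by fun_prop : Continuous fun s : Circle => (s : ℂ)).measurable
    exact (Real.measurable_log.comp (by fun_prop)).stronglyMeasurable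
  have h1 := integral_twoArcMeasure θ₀ θ₁ hm
  have h2 : ∫ s : Circle, Real.log ‖(1 + (s : ℂ)) / (1 - (s : ℂ))‖ ∂twoArcMeasure θ₀ θ₁ =
      (∫ s : Circle, Real.log ‖(Circle.exp π : ℂ) - s‖ ∂twoArcMeasure θ₀ θ₁) -
        ∫ s : Circle, Real.log ‖(Circle.exp 0 : ℂ) - s‖ ∂twoArcMeasure θ₀ θ₁ := by
    rw [← integral_sub i2 i1]
    refine integral_congr_ae ?_
    filter_upwards [compl_mem_ae_iff.2 (measure_singleton (μ := twoArcMeasure θ₀ θ₁) 1),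
      compl_mem_ae_iff.2 (measure_singleton (μ := twoArcMeasure θ₀ θ₁) (-1))] with s hs1 hs2
    have e1 : (1 : ℂ) - s ≠ 0 := fun h' => hs1 (Circle.ext (by simpa using (sub_eq_zero.1 h').symm))
    have e2 : (1 : ℂ) + s ≠ 0 := fun h' => hs2 (Circle.ext (by
      simpa using (eq_neg_of_add_eq_zero_right h')))
    have e3 : (Circle.exp π : ℂ) - s = -(1 + s) := by
      rw [Circle.coe_exp, Complex.exp_pi_mul_I]
      ring
    rw [e3, norm_neg, Circle.exp_zero, Circle.coe_one, norm_div,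
      Real.log_div (norm_ne_zero_iff.2 e2) (norm_ne_zero_iff.2 e1)]
  have h3 : 2 * ∫ θ in twoArcAngles θ₀ θ₁,
      Real.log ‖(1 + (Circle.exp θ : ℂ)) / (1 - (Circle.exp θ : ℂ))‖ * twoArcDensity θ₀ θ₁ θ =
      gapIntegral θ₀ θ₁ := by
    simp_rw [mul_comm (Real.log _)]
    simp only [smul_eq_mul] at h1
    rw [← h1, h2, mul_sub, v1, v2, abs_zero, intervalIntegral.integral_same,
      abs_of_nonneg pi_nonneg]
    simp only [gapIntegral, gapDensity]
    ring
  rw [EndpointEquation, h3]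

end Admissible

end CircleEquilibrium

open CircleEquilibrium in
theorem mainTheorem3 (θ₀ : ℝ) (hθ₀ : θ₀ ∈ Set.Ioo 0 Real.pi) :
    -- the case `x ≥ x_c`, with `x = ⊤` included
    (∀ x : EReal, (CircleEquilibrium.xCrit θ₀ : EReal) ≤ x →
      let V := CircleEquilibrium.potential θ₀ x
      let γ := CircleEquilibrium.gammaArc θ₀
      let μ := CircleEquilibrium.angularMeasure (Set.Icc (-θ₀) θ₀)
        (CircleEquilibrium.oneArcDensity θ₀)
      let ℓ : ℝ := -2 * Real.log (Real.sin (θ₀ / 2))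
      (∀ ν : MeasureTheory.Measure Circle,
        CircleEquilibrium.IsEquilibriumMeasure V ν ↔ ν = μ) ∧
      μ.support = γ ∧
      (∀ ℓ' : ℝ, CircleEquilibrium.SatisfiesEulerLagrange V μ ℓ' ↔ ℓ' = ℓ) ∧
      (x ≠ (CircleEquilibrium.xCrit θ₀ : EReal) →
        ∀ z ∉ γ, CircleEquilibrium.eulerLagrange V μ ℓ z < 0) ∧
      (x = (CircleEquilibrium.xCrit θ₀ : EReal) →
        (∀ z ∉ γ, z ≠ -1 → CircleEquilibrium.eulerLagrange V μ ℓ z < 0) ∧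
        CircleEquilibrium.eulerLagrange V μ ℓ (-1) = 0)) ∧
    -- the case `0 < x < x_c`
    (∀ x : ℝ, 0 < x → x < CircleEquilibrium.xCrit θ₀ →
      ∃ θ₁ ∈ Set.Ioo 0 (Real.pi - θ₀),
        CircleEquilibrium.EndpointEquation θ₀ x θ₁ ∧
        (∀ t ∈ Set.Ioo 0 (Real.pi - θ₀),
          CircleEquilibrium.EndpointEquation θ₀ x t → t = θ₁) ∧
        let V := CircleEquilibrium.potential θ₀ (x : EReal)
        let J := CircleEquilibrium.arcSet (CircleEquilibrium.twoArcAngles θ₀ θ₁)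
        let μ := CircleEquilibrium.angularMeasure (CircleEquilibrium.twoArcAngles θ₀ θ₁)
          (CircleEquilibrium.twoArcDensity θ₀ θ₁)
        let ℓ : ℝ := -∫ s in (0 : ℝ)..1, CircleEquilibrium.ellIntegrand θ₀ θ₁ s
        (∀ ν : MeasureTheory.Measure Circle,
          CircleEquilibrium.IsEquilibriumMeasure V ν ↔ ν = μ) ∧
        μ.support = J ∧
        Disjoint (CircleEquilibrium.gammaArc θ₀)
          (CircleEquilibrium.arcSet (Set.Icc (Real.pi - θ₁) (Real.pi + θ₁))) ∧
        IntervalIntegrable (CircleEquilibrium.ellIntegrand θ₀ θ₁) MeasureTheory.volume 0 1 ∧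
        (∀ ℓ' : ℝ, CircleEquilibrium.SatisfiesEulerLagrange V μ ℓ' ↔ ℓ' = ℓ) ∧
        (∀ z ∉ J, CircleEquilibrium.eulerLagrange V μ ℓ z < 0)) := by
  obtain ⟨h0, hπ⟩ := hθ₀
  have hγ : ∀ {x : EReal} {φ : ℝ}, |φ| ≤ π → |φ| ≤ θ₀ →
      potential θ₀ x (Circle.exp φ) = 0 := fun hφ h1 =>
    if_pos ((circleExp_mem_gammaArc_iff hπ.le hφ).2 h1)
  have hγ' : ∀ {x : EReal} {φ : ℝ}, |φ| ≤ π → θ₀ < |φ| →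
      potential θ₀ x (Circle.exp φ) = x := fun hφ h1 =>
    if_neg fun h2 => h1.not_ge ((circleExp_mem_gammaArc_iff hπ.le hφ).1 h2)
  refine ⟨fun x hx => ?_, fun x hx0 hx => ?_⟩
  · have h : Admissible θ₀ 0 := ⟨h0, hπ, le_rfl, by linarith⟩
    -- the critical value is the increment of the potential for the degenerate second arc
    rw [← gapIntegral_zero h0 hπ] at hx ⊢
    have hx0 : (0 : EReal) ≤ x := by
      refine le_trans ?_ hx
      have := h.integral_gapDensity_le le_rfl pi_nonneg
      rw [intervalIntegral.integral_same] at this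
      exact_mod_cast this
    have hℓ : -2 * Real.log (Real.sin (θ₀ / 2)) = -∫ s in (0 : ℝ)..1, ellIntegrand θ₀ 0 s := by
      rw [integral_ellIntegrand_zero h0 hπ]
      ring
    have hV0 : ∀ z, 0 ≤ potential θ₀ x z := fun z => by
      unfold potential
      split_ifs
      · exact le_rfl
      · exact hx0
    have hsupp : (twoArcMeasure θ₀ 0).support = gammaArc θ₀ := by
      refine subset_antisymm ?_ h.gammaArc_subset_support
      refine Measure.support_subset_of_isClosed (isClosed_arcSet_Icc _ _) ?_
      rw [← angularMeasure_oneArc, mem_ae_iff]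
      exact angularMeasure_compl_arcSet _ (isClosed_arcSet_Icc _ _)
    have hle : ∀ φ : ℝ, |φ| ≤ π → ((∫ t in (0 : ℝ)..|φ|, gapDensity θ₀ 0 t : ℝ) : EReal) ≤
        potential θ₀ x (Circle.exp φ) := fun φ hφ => by
      rcases le_or_gt |φ| θ₀ with h1 | h1
      · rw [hγ hφ h1, h.integral_gapDensity_eq_zero (abs_nonneg φ) h1, EReal.coe_zero]
      · rw [hγ' hφ h1]
        exact (EReal.coe_le_coe_iff.2 (h.integral_gapDensity_le (abs_nonneg φ) hφ)).trans hx
    obtain ⟨hmin, hEL⟩ := h.equilibrium (measurable_potential θ₀ x) hV0 hle fun φ hφ hmem => by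
      rw [hsupp, circleExp_mem_gammaArc_iff hπ.le hφ] at hmem
      rw [hγ hφ hmem, h.integral_gapDensity_eq_zero (abs_nonneg φ) hmem, EReal.coe_zero]
    rw [angularMeasure_oneArc, hℓ]
    refine ⟨hmin, hsupp, hEL, fun hne z hz => ?_, fun hxeq => ⟨fun z hz hz1 => ?_, ?_⟩⟩
    · obtain ⟨φ, hφ, rfl⟩ := exists_circleExp_eq z
      rw [circleExp_mem_gammaArc_iff hπ.le hφ, not_le] at hz
      refine h.eulerLagrange_neg hφ ?_
      rw [hγ' hφ hz]
      exact (EReal.coe_le_coe_iff.2 (h.integral_gapDensity_le (abs_nonneg φ) hφ)).trans_lt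
        (lt_of_le_of_ne hx hne.symm)
    · obtain ⟨φ, hφ, rfl⟩ := exists_circleExp_eq z
      rw [circleExp_mem_gammaArc_iff hπ.le hφ, not_le] at hz
      have h1 : |φ| < π := by
        refine lt_of_le_of_ne hφ fun h2 => hz1 ?_
        rcases eq_or_eq_neg_of_abs_eq h2 with rfl | rfl <;>
          exact Circle.ext (by simp [Circle.coe_exp])
      refine h.eulerLagrange_neg hφ ?_
      rw [hγ' hφ hz, hxeq, EReal.coe_lt_coe_iff]
      exact h.integral_gapDensity_lt (abs_nonneg φ) (by rwa [sub_zero])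
    · have h1 : (-1 : Circle) = Circle.exp π := Circle.ext (by simp [Circle.coe_exp])
      have h2 : |π| = π := abs_of_nonneg pi_nonneg
      rw [h1, h.eulerLagrange_eq _ _ h2.le, hγ' h2.le (by rwa [h2]), h2, hxeq, ← EReal.coe_sub,
        ← EReal.coe_add, ← EReal.coe_zero, EReal.coe_eq_coe_iff, gapIntegral]
      ring
  · have hcont := (continuous_gapIntegral h0 hπ).continuousOn (s := Icc 0 (π - θ₀))
    have hanti := gapIntegral_strictAntiOn h0 hπ
    -- the increment decreases from `x_c` to `0`, so that it takes the value `x`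
    obtain ⟨θ₁, hθ₁, hval⟩ := intermediate_value_Ioo' (by linarith) hcont
      (show x ∈ Ioo (gapIntegral θ₀ (π - θ₀)) (gapIntegral θ₀ 0) by
        rw [gapIntegral_pi_sub, gapIntegral_zero h0 hπ]
        exact ⟨hx0, hx⟩)
    have hadm : ∀ t ∈ Ioo 0 (π - θ₀), Admissible θ₀ t := fun t ht =>
      ⟨h0, hπ, ht.1.le, by linarith [ht.2]⟩
    have h := hadm θ₁ hθ₁
    have hθ₁π : θ₁ ≤ π := by linarith [hθ₁.2]
    have hV0 : ∀ z, 0 ≤ potential θ₀ (x : EReal) z := fun z => by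
      unfold potential
      split_ifs
      · exact le_rfl
      · exact_mod_cast hx0.le
    have hsupp := h.support_twoArcMeasure hθ₁.1
    have hmemJ : ∀ φ : ℝ, |φ| ≤ π →
        (Circle.exp φ ∈ arcSet (twoArcAngles θ₀ θ₁) ↔ |φ| ≤ θ₀ ∨ π - θ₁ ≤ |φ|) := fun φ hφ => by
      rw [twoArcAngles, arcSet_union, mem_union, circleExp_mem_arcSet_iff hθ₁π hφ]
      exact or_congr_left (circleExp_mem_gammaArc_iff hπ.le hφ)
    have hle : ∀ φ : ℝ, |φ| ≤ π → ((∫ t in (0 : ℝ)..|φ|, gapDensity θ₀ θ₁ t : ℝ) : EReal) ≤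
        potential θ₀ x (Circle.exp φ) := fun φ hφ => by
      rcases le_or_gt |φ| θ₀ with h1 | h1
      · rw [hγ hφ h1, h.integral_gapDensity_eq_zero (abs_nonneg φ) h1, EReal.coe_zero]
      · rw [hγ' hφ h1, ← hval]
        exact EReal.coe_le_coe_iff.2 (h.integral_gapDensity_le (abs_nonneg φ) hφ)
    obtain ⟨hmin, hEL⟩ := h.equilibrium (measurable_potential θ₀ x) hV0 hle fun φ hφ hmem => by
      rw [hsupp, hmemJ φ hφ] at hmem
      rcases hmem with h1 | h1
      · rw [hγ hφ h1, h.integral_gapDensity_eq_zero (abs_nonneg φ) h1, EReal.coe_zero]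
      · rw [hγ' hφ (by linarith [h.add_lt]), h.integral_gapDensity_eq h1 hφ, hval]
    refine ⟨θ₁, hθ₁, (h.endpointEquation_iff x).2 hval, fun t ht hEq => ?_, hmin, hsupp, ?_,
      h.intervalIntegrable_ellIntegrand, hEL, fun z hz => ?_⟩
    · refine hanti.injOn ⟨ht.1.le, ht.2.le⟩ ⟨hθ₁.1.le, hθ₁.2.le⟩ ?_
      rw [((hadm t ht).endpointEquation_iff x).1 hEq, hval]
    · rw [Set.disjoint_left]
      intro z hz1 hz2
      obtain ⟨φ, hφ, rfl⟩ := exists_circleExp_eq z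
      rw [circleExp_mem_gammaArc_iff hπ.le hφ] at hz1
      rw [circleExp_mem_arcSet_iff hθ₁π hφ] at hz2
      linarith [h.add_lt]
    · obtain ⟨φ, hφ, rfl⟩ := exists_circleExp_eq z
      rw [hmemJ φ hφ, not_or, not_le, not_le] at hz
      refine h.eulerLagrange_neg hφ ?_
      rw [hγ' hφ hz.1, ← hval, EReal.coe_lt_coe_iff]
      exact h.integral_gapDensity_lt (abs_nonneg φ) hz.2
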